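/- **Fermionic encodings and disparity.** Let $G$ be a finite connected graph with $M$ vertices (fermionic modes). Let $M_G$ be the group generated by the phases $\{\pm1,\pm i\}$ (central), the vertices $v_j$ and the directed edges $e_{jk}$ of $G$, subject to $e_{jk}^2=v_j^2=1$, $e_{jk}=-e_{kj}$, $\{e_{jk},v_k\}=0$, $\{e_{jk},e_{kl}\}=0$ for $j\ne l$, and all other pairs (distinct vertices; an edge and a vertex not on it; disjoint edges) commuting. Let $\mathcal C_G\le M_G$ be the group of the elements $i^{n}e_{x_0x_1}\cdots e_{x_{n-1}x_n}$ for closed walks $x_0,\dots,x_n=x_0$ in $G$. For a representation $\sigma$ of $M_G$ by Pauli operators on $N$ qubits put $S=\sigma(\mathcal C_G)$ (the stabilizer group); $\sigma$ is an encoding if $-1\notin S$. Its disparity is $\Delta:=N-M-D(S)$, where $D(S)$ is the minimal number of generators of $S$. **Kagome lattices.** In the Kagome tiling of the plane (the uniform tiling 3.6.3.6, drawn with horizontal edges) every edge is a side of one hexagon and of one triangle. A Kagome lattice is a finite nonempty subgraph $G$ of the graph of the tiling that is a union of boundaries of faces of the tiling and that contains the third side of any triangular face of which it contains two sides. Its faces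 are the faces of the tiling all of whose sides lie in $G$. It has no holes if every bounded component of the complement of $G$ in the plane is one of its faces. Let $HF$ and $TF$ be the numbers of its hexagonal and triangular faces, and $TC$ the number of its triangular corners, that is, of the vertices of $G$ that belong to exactly one face of the lattice, this face being a triangle. **The encoding.** There is one qubit for each vertex of $G$ and one for each triangular face of the lattice. Put $\sigma(v_j)=Z_j$. For an edge from $j$ to $k$, lying on the triangle $t$ of the tiling, put $\sigma(e_{jk})=\pm P_jP_kR_t$, where $P=X$ if $t$ points upwards and $P=Y$ if $t$ points downwards; the factor $R_t$ is present only if $t$ is a face of the lattice, and acts on its qubit with $R=Z,Y,X$ according as the edge is horizontal, at $60^\circ$, or at $120^\circ$ to the horizontal; the sign is $+$ if the edge is directed counterclockwise around $t$, and $-$ otherwise. This defines a representation of $M_G$. **Proposition.** For every connected Kagome lattice without holes, $-1\notin S$, so that $\sigma$ is an encoding, and its disparity is $$\Delta = HF+TC-2=\tfrac12\,(TF+TC-2).$$ -/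

import Mathlib

/-! ### Fermionic encodings on graphs -/

namespace Fermi

section Group

variable {V : Type} (G : SimpleGraph V)

/-- Generators of `M_G`: the phase `i`, the vertices, and the directed edges of `G`. -/
inductive Gen
  | phase : Gen
  | vert : V → Gen
  | edge : G.Dart → Gen

/-- The phase `i` in the free group. -/
def fI : FreeGroup (Gen G) := FreeGroup.of Gen.phase
/-- A vertex generator in the free group. -/
def fv (x : V) : FreeGroup (Gen G) := FreeGroup.of (Gen.vert x)
/-- A directed edge generator in the free group. -/
def fe (d : G.Dart) : FreeGroup (Gen G) := FreeGroup.of (Gen.edge d)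

/-- The defining relations `l = r` of `M_G`.  The phases `{1, i, -1, -i}` are the powers of a
central element `i` with `i ^ 4 = 1`, so that `-1` is `i ^ 2`. -/
inductive Rel : FreeGroup (Gen G) → FreeGroup (Gen G) → Prop
  | phase_pow : Rel (fI G ^ 4) 1
  | phase_central (x : Gen G) : Rel (fI G * FreeGroup.of x) (FreeGroup.of x * fI G)
  | vert_sq (x : V) : Rel (fv G x ^ 2) 1
  | edge_sq (d : G.Dart) : Rel (fe G d ^ 2) 1
  | edge_symm (d : G.Dart) : Rel (fe G d) (fI G ^ 2 * fe G d.symm)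
  | vert_vert (x y : V) : x ≠ y → Rel (fv G x * fv G y) (fv G y * fv G x)
  | edge_vert (d : G.Dart) (x : V) : x ≠ d.fst → x ≠ d.snd →
      Rel (fe G d * fv G x) (fv G x * fe G d)
  | edge_edge (d d' : G.Dart) : d.fst ≠ d'.fst → d.fst ≠ d'.snd → d.snd ≠ d'.fst →
      d.snd ≠ d'.snd → Rel (fe G d * fe G d') (fe G d' * fe G d)
  | edge_vert_anti (d : G.Dart) :
      Rel (fe G d * fv G d.snd) (fI G ^ 2 * (fv G d.snd * fe G d))
  | edge_edge_anti (d d' : G.Dart) : d.snd = d'.fst → d.fst ≠ d'.snd →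
      Rel (fe G d * fe G d') (fI G ^ 2 * (fe G d' * fe G d))

/-- The group `M_G` attached to a fermionic graph `G`. -/
abbrev MG : Type := PresentedGroup {w | ∃ l r, Rel G l r ∧ w = l * r⁻¹}

/-- The element of `M_G` attached to a closed walk `x₀, x₁, …, xₙ = x₀`, namely
`i ^ n * e_{x₀x₁} * ⋯ * e_{xₙ₋₁xₙ}`. -/
def cycleElt {x : V} (w : G.Walk x x) : MG G :=
  PresentedGroup.of Gen.phase ^ w.length *
    (w.darts.map fun d => PresentedGroup.of (Gen.edge d)).prod

/-- The cycle group `C_G`.  (If `G` is connected then the set of all `cycleElt w` is already closed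
under products and inverses.) -/
def cycleGroup : Subgroup (MG G) :=
  Subgroup.closure {g | ∃ (x : V) (w : G.Walk x x), g = cycleElt G w}

end Group

/-- The rank `D(S)`: the minimal size of a finite generating set of a (finitely generated)
subgroup. -/
noncomputable def minGen {X : Type} [Group X] (S : Subgroup X) : ℕ :=
  sInf {n | ∃ s : Finset X, s.card = n ∧ Subgroup.closure (s : Set X) = S}

/-- Linear operators on the Hilbert space of the qubits `Q` (for finite `Q`), written in the
computational basis, whose elements are the bit strings `Q → Fin 2`. -/
abbrev Op (Q : Type) : Type := Module.End ℂ ((Q → Fin 2) → ℂ)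

section Stabilizer

variable {V Q : Type} {G : SimpleGraph V}

/-- The stabilizer group `S = σ(C_G)`. -/
def stabilizer (σ : MG G →* (Op Q)ˣ) : Subgroup (Op Q)ˣ := (cycleGroup G).map σ

/-- The disparity `Δ = N - M - D(S)`, with `N` qubits and `M` modes. -/
noncomputable def disparity (σ : MG G →* (Op Q)ˣ) : ℤ :=
  (Nat.card Q : ℤ) - (Nat.card V : ℤ) - (minGen (stabilizer σ) : ℤ)

end Stabilizer

/-! ### Pauli operators -/

/-- The nontrivial Pauli labels. -/
inductive Pauli
  | X | Y | Z

/-- The Pauli matrices. -/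
def Pauli.mat : Pauli → Matrix (Fin 2) (Fin 2) ℂ
  | .X => !![0, 1; 1, 0]
  | .Y => !![0, -Complex.I; Complex.I, 0]
  | .Z => !![1, 0; 0, -1]

section Ops

variable {Q : Type}

open Classical in
/-- The operator acting as the matrix `A` on the qubit `q` and as the identity elsewhere. -/
noncomputable def opOn (q : Q) (A : Matrix (Fin 2) (Fin 2) ℂ) : Op Q where
  toFun ψ b := ∑ s : Fin 2, A (b q) s * ψ (Function.update b q s)
  map_add' ψ φ := by
    funext b; simp only [Fin.sum_univ_two, Pi.add_apply]; ring
  map_smul' c ψ := by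
    funext b; simp only [Fin.sum_univ_two, Pi.smul_apply, smul_eq_mul, RingHom.id_apply]; ring

theorem opOn_mul (q : Q) (A B : Matrix (Fin 2) (Fin 2) ℂ) :
    opOn q A * opOn q B = opOn q (A * B) := by
  classical
  ext1 ψ
  funext b
  simp only [opOn, Module.End.mul_apply, LinearMap.coe_mk, AddHom.coe_mk, Fin.sum_univ_two,
    Function.update_self, Function.update_idem, Matrix.mul_apply]
  ring

theorem opOn_one (q : Q) : opOn q (1 : Matrix (Fin 2) (Fin 2) ℂ) = 1 := by
  classical
  ext1 ψ
  funext b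
  have h : ∀ s : Fin 2, s = b q → Function.update b q s = b := by
    intro s hs; subst hs; simp
  simp only [opOn, LinearMap.coe_mk, AddHom.coe_mk, Module.End.one_apply, Matrix.one_apply]
  rw [Finset.sum_eq_single (b q)]
  · simp
  · intro s _ hs; simp [Ne.symm hs]
  · simp

theorem opOn_smul (q : Q) (c : ℂ) (A : Matrix (Fin 2) (Fin 2) ℂ) :
    opOn q (c • A) = c • opOn q A := by
  classical
  ext1 ψ
  funext b
  simp only [opOn, LinearMap.coe_mk, AddHom.coe_mk, Fin.sum_univ_two, LinearMap.smul_apply,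
    Pi.smul_apply, Matrix.smul_apply, smul_eq_mul]
  ring

theorem opOn_comm {q q' : Q} (h : q ≠ q') (A B : Matrix (Fin 2) (Fin 2) ℂ) :
    opOn q A * opOn q' B = opOn q' B * opOn q A := by
  classical
  ext1 ψ
  funext b
  have hu : ∀ s s' : Fin 2, Function.update (Function.update b q s) q' s' =
      Function.update (Function.update b q' s') q s := by
    intro s s'; exact Function.update_comm h s s' b
  simp only [opOn, Module.End.mul_apply, LinearMap.coe_mk, AddHom.coe_mk, Fin.sum_univ_two,
    Function.update_of_ne h, Function.update_of_ne h.symm, hu]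
  ring

theorem Pauli.mat_sq (P : Pauli) : P.mat * P.mat = 1 := by
  cases P <;> (ext i j; fin_cases i <;> fin_cases j <;> simp [Pauli.mat])

theorem Pauli.mat_anti {P P' : Pauli} (h : P ≠ P') :
    P.mat * P'.mat = (-1 : ℂ) • (P'.mat * P.mat) := by
  cases P <;> cases P' <;> first
    | exact absurd rfl h
    | (ext i j; fin_cases i <;> fin_cases j <;> simp [Pauli.mat])

theorem op_neg_smul (c : ℂ) (a : Op Q) : (-c) • a = -(c • a) := by
  ext1 ψ
  funext b
  simp

theorem op_neg_one_mul (a : Op Q) : -1 * a = -a := by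
  ext1 ψ
  funext b
  simp

/-- `a` and `b` commute up to the scalar `s`. -/
def Skew (s : ℂ) (a b : Op Q) : Prop := a * b = s • (b * a)

theorem Skew.mulRight {s t : ℂ} {a b c : Op Q} (h : Skew s a b) (k : Skew t a c) :
    Skew (s * t) a (b * c) := by
  unfold Skew at *
  rw [← mul_assoc, h, smul_mul_assoc, mul_assoc, k, mul_smul_comm, smul_smul, mul_assoc]

theorem Skew.mulLeft {s t : ℂ} {a b c : Op Q} (h : Skew s a c) (k : Skew t b c) :
    Skew (s * t) (a * b) c := by
  unfold Skew at *
  rw [mul_assoc, k, mul_smul_comm, ← mul_assoc, h, smul_mul_assoc, smul_smul, mul_assoc,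
    mul_comm t s]

theorem Skew.smulLeft {s : ℂ} {a b : Op Q} (h : Skew s a b) (c : ℂ) : Skew s (c • a) b := by
  unfold Skew at *
  rw [smul_mul_assoc, h, mul_smul_comm, smul_comm]

theorem Skew.smulRight {s : ℂ} {a b : Op Q} (h : Skew s a b) (c : ℂ) : Skew s a (c • b) := by
  unfold Skew at *
  rw [mul_smul_comm, h, smul_mul_assoc, smul_comm]

theorem skew_one_left (a : Op Q) : Skew 1 (1 : Op Q) a := by simp [Skew]

theorem skew_one_right (a : Op Q) : Skew 1 a (1 : Op Q) := by simp [Skew]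

theorem skew_self (a : Op Q) : Skew 1 a a := by simp [Skew]

theorem skew_ne {q q' : Q} (h : q ≠ q') (A B : Matrix (Fin 2) (Fin 2) ℂ) :
    Skew 1 (opOn q A) (opOn q' B) := by
  simp [Skew, opOn_comm h]

theorem skew_anti (q : Q) {P P' : Pauli} (h : P ≠ P') :
    Skew (-1) (opOn q P.mat) (opOn q P'.mat) := by
  simp only [Skew, opOn_mul, Pauli.mat_anti h, opOn_smul]

theorem opOn_sq (q : Q) (P : Pauli) : opOn q P.mat * opOn q P.mat = 1 := by
  rw [opOn_mul, P.mat_sq, opOn_one]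

/-- An involution as a unit. -/
def invol (a : Op Q) (h : a * a = 1) : (Op Q)ˣ := ⟨a, a, h, h⟩

/-- The scalar operator `i`. -/
noncomputable def opI : (Op Q)ˣ where
  val := Complex.I • 1
  inv := (-Complex.I) • 1
  val_inv := by simp [smul_smul]
  inv_val := by simp [smul_smul]

end Ops

end Fermi

/-! ### The Kagome tiling -/

namespace Kagome

/-- The pair `(a, b)` stands for the point `a (1, 0) + b (1/2, √3/2)` of the plane.  Sites of the
Kagome tiling are the points at which `a`, `b` are not both even; the points with `a`, `b` both
even are the centres of the hexagons. -/
def IsSite (p : ℤ × ℤ) : Prop := ¬ (Even p.1 ∧ Even p.2)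

/-- The differences of points at unit distance, in counterclockwise order. -/
def unitVec : Fin 6 → ℤ × ℤ := ![(1, 0), (0, 1), (-1, 1), (-1, 0), (0, -1), (1, -1)]

/-- The infinite Kagome graph: sites at unit distance are adjacent.  (Points that are not sites are
isolated.) -/
def kagome : SimpleGraph (ℤ × ℤ) where
  Adj p q := IsSite p ∧ IsSite q ∧ ∃ k, q = p + unitVec k
  symm := ⟨by
    rintro p q ⟨hp, hq, k, rfl⟩
    refine ⟨hq, hp, k + 3, ?_⟩
    fin_cases k <;> simp [unitVec, Prod.ext_iff]⟩
  loopless := ⟨by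
    rintro p ⟨-, -, k, hk⟩
    fin_cases k <;> simp [unitVec, Prod.ext_iff] at hk⟩

/-- The triangular faces of the tiling: `⟨true, m, n⟩` points upwards, `⟨false, m, n⟩` points
downwards, and both have the site `(2m+1, 2n+1)` as a corner. -/
structure Tri where
  up : Bool
  m : ℤ
  n : ℤ

/-- `1` for upward and `-1` for downward triangles. -/
def Tri.sgn (t : Tri) : ℤ := if t.up then 1 else -1

/-- The corners of a triangular face, in counterclockwise order. -/
def Tri.corner (t : Tri) : Fin 3 → ℤ × ℤ :=
  ![(2 * t.m + 1, 2 * t.n + 1), (2 * t.m + 1 + t.sgn, 2 * t.n + 1),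
    (2 * t.m + 1, 2 * t.n + 1 + t.sgn)]

/-- The corners of a triangular face. -/
def Tri.verts (t : Tri) : Set (ℤ × ℤ) := Set.range t.corner

/-- The bounded faces of the Kagome tiling; `hex m n` is the hexagon centred at `(2m, 2n)`. -/
inductive Face
  | hex : ℤ → ℤ → Face
  | tri : Tri → Face

/-- The corners of a face. -/
def Face.verts : Face → Set (ℤ × ℤ)
  | .hex m n => Set.range fun k => ((2 * m, 2 * n) : ℤ × ℤ) + unitVec k
  | .tri t => t.verts

/-- A face of the tiling is a face of the subgraph `H` if `H` contains all its sides. -/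
def HasFace (H : kagome.Subgraph) (f : Face) : Prop :=
  ∀ p ∈ f.verts, ∀ q ∈ f.verts, kagome.Adj p q → H.Adj p q

/-- A (finite) Kagome lattice: a finite union of faces of the tiling, which contains the third side
of a triangular face as soon as it contains the two others. -/
structure IsLattice (H : kagome.Subgraph) : Prop where
  finite : H.verts.Finite
  vert_face : ∀ p ∈ H.verts, ∃ f, HasFace H f ∧ p ∈ f.verts
  edge_face : ∀ p q, H.Adj p q → ∃ f, HasFace H f ∧ p ∈ f.verts ∧ q ∈ f.verts
  tri_closed : ∀ t : Tri, ∀ p ∈ t.verts, ∀ q ∈ t.verts, ∀ r ∈ t.verts,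
    p ≠ r → H.Adj p q → H.Adj q r → H.Adj p r

/-- Faces of the tiling that share a side which is not in `H`.  The components of this graph are the
connected components of the complement of `H` in the plane. -/
def dualOff (H : kagome.Subgraph) : SimpleGraph Face where
  Adj f g := f ≠ g ∧ ∃ p q, kagome.Adj p q ∧ ¬ H.Adj p q ∧
    p ∈ f.verts ∧ q ∈ f.verts ∧ p ∈ g.verts ∧ q ∈ g.verts
  symm := ⟨fun _ _ ⟨h, p, q, a, b, c, d, e, k⟩ => ⟨h.symm, p, q, a, b, e, k, c, d⟩⟩
  loopless := ⟨fun _ h => h.1 rfl⟩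

/-- `H` has no holes: a face of the tiling that is not a face of `H` lies in the unbounded component
of the complement of `H`, that is, in one that consists of infinitely many faces. -/
def NoHoles (H : kagome.Subgraph) : Prop :=
  ∀ f, ¬ HasFace H f → {g | (dualOff H).Reachable f g}.Infinite

/-- The number of hexagonal faces. -/
noncomputable def HF (H : kagome.Subgraph) : ℕ :=
  {c : ℤ × ℤ | HasFace H (.hex c.1 c.2)}.ncard

/-- The number of triangular faces. -/
noncomputable def TF (H : kagome.Subgraph) : ℕ := {t : Tri | HasFace H (.tri t)}.ncard

/-- The number of triangular corners: vertices which belong to exactly one face, a triangular one.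
(Such a vertex is on the boundary of the lattice, since four faces of the tiling meet there.) -/
noncomputable def TC (H : kagome.Subgraph) : ℕ :=
  {p ∈ H.verts | ∃ t, HasFace H (.tri t) ∧ p ∈ t.verts ∧
    ∀ f, HasFace H f → p ∈ f.verts → f = .tri t}.ncard

/-! ### Elementary facts on triangles -/

theorem Tri.mem_verts {t : Tri} {p : ℤ × ℤ} : p ∈ t.verts ↔
    (p.1 = 2 * t.m + 1 ∧ p.2 = 2 * t.n + 1) ∨
    (p.1 = 2 * t.m + 1 + t.sgn ∧ p.2 = 2 * t.n + 1) ∨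
    (p.1 = 2 * t.m + 1 ∧ p.2 = 2 * t.n + 1 + t.sgn) := by
  simp only [Tri.verts, Set.mem_range, Tri.corner]
  constructor
  · rintro ⟨k, rfl⟩
    fin_cases k <;> simp
  · rintro (h | h | h)
    · exact ⟨0, by simp [Prod.ext_iff, h.1, h.2]⟩
    · exact ⟨1, by simp [Prod.ext_iff, h.1, h.2]⟩
    · exact ⟨2, by simp [Prod.ext_iff, h.1, h.2]⟩

theorem Tri.eq_of_mem {t t' : Tri} {p : ℤ × ℤ} (h : p ∈ t.verts) (h' : p ∈ t'.verts)
    (hu : t.up = t'.up) : t = t' := by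
  rw [Tri.mem_verts] at h h'
  obtain ⟨u, m, n⟩ := t
  obtain ⟨u', m', n'⟩ := t'
  simp only at hu
  subst hu
  cases u <;> simp only [Tri.sgn, Bool.false_eq_true, if_true, if_false] at h h' <;>
    (simp only [Tri.mk.injEq, true_and]; omega)

theorem Tri.eq_of_mem₂ {t t' : Tri} {p q : ℤ × ℤ} (hpq : p ≠ q) (h : p ∈ t.verts)
    (h' : p ∈ t'.verts) (k : q ∈ t.verts) (k' : q ∈ t'.verts) : t = t' := by
  refine Tri.eq_of_mem h h' ?_
  rw [Tri.mem_verts] at h h' k k'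
  obtain ⟨u, m, n⟩ := t
  obtain ⟨u', m', n'⟩ := t'
  rw [Ne, Prod.ext_iff] at hpq
  cases u <;> cases u' <;>
    simp only [Tri.sgn, Bool.false_eq_true, if_true, if_false] at h h' k k' <;>
    first | rfl | omega

theorem exists_tri {p q : ℤ × ℤ} (h : kagome.Adj p q) :
    ∃ t : Tri, p ∈ t.verts ∧ q ∈ t.verts := by
  obtain ⟨hp, hq, k, hk⟩ := h
  have key : ∃ (u : Bool) (m n : ℤ), p ∈ (Tri.mk u m n).verts ∧ q ∈ (Tri.mk u m n).verts := by
    simp only [Tri.mem_verts, IsSite, Int.even_iff] at *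
    by_cases hu : min p.1 q.1 % 2 = 1 ∧ min p.2 q.2 % 2 = 1
    · refine ⟨true, min p.1 q.1 / 2, min p.2 q.2 / 2, ?_⟩
      fin_cases k <;> simp [unitVec, Prod.ext_iff] at hk <;> simp only [Tri.sgn, if_true] <;> omega
    · refine ⟨false, max p.1 q.1 / 2, max p.2 q.2 / 2, ?_⟩
      fin_cases k <;> simp [unitVec, Prod.ext_iff] at hk <;>
        simp only [Tri.sgn, Bool.false_eq_true, if_false] <;> omega
  obtain ⟨u, m, n, hh⟩ := key
  exact ⟨_, hh⟩

/-! ### The encoding -/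

open Fermi

instance : Nonempty Tri := ⟨⟨true, 0, 0⟩⟩

/-- The triangular face of the tiling on which the edge `pq` lies. -/
noncomputable def triOf (p q : ℤ × ℤ) : Tri :=
  Classical.epsilon fun t : Tri => p ∈ t.verts ∧ q ∈ t.verts

theorem triOf_spec {p q : ℤ × ℤ} (h : kagome.Adj p q) :
    p ∈ (triOf p q).verts ∧ q ∈ (triOf p q).verts :=
  Classical.epsilon_spec (exists_tri h)

theorem triOf_symm (p q : ℤ × ℤ) : triOf p q = triOf q p := by
  simp only [triOf, and_comm]

/-- The Pauli with which the edge operator acts on its two vertex qubits: `X` on the sides of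
upward triangles, `Y` on the sides of downward triangles. -/
noncomputable def endPauli (p q : ℤ × ℤ) : Pauli :=
  if (triOf p q).up then .X else .Y

/-- The Pauli with which the edge operator acts on the face qubit: it depends on the direction of
the edge only, so that the three sides of a triangle act with three different Paulis. -/
def facePauli (p q : ℤ × ℤ) : Pauli :=
  if p.2 = q.2 then .Z else if p.1 = q.1 then .Y else .X

open Classical in
/-- The sign of the edge operator: `1` on edges directed counterclockwise around their triangle,
and `-1` on edges directed clockwise. -/
noncomputable def edgeSign (p q : ℤ × ℤ) : ℂ :=
  if ∃ k, p = (triOf p q).corner k ∧ q = (triOf p q).corner (k + 1) then 1 else -1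

/-- The qubits: one for every vertex and one for every triangular face of the lattice. -/
abbrev Qubit (H : kagome.Subgraph) : Type := H.verts ⊕ {t : Tri // HasFace H (.tri t)}

open Classical in
/-- The action of the edge operator on the qubit of the adjacent triangular face, if that is a face
of the lattice. -/
noncomputable def faceOp (H : kagome.Subgraph) (p q : H.verts) : Op (Qubit H) :=
  if h : HasFace H (.tri (triOf p q)) then opOn (Sum.inr ⟨triOf p q, h⟩) (facePauli p q).mat else 1

/-- The encoded edge operator. -/
noncomputable def edgeOp (H : kagome.Subgraph) (p q : H.verts) : Op (Qubit H) :=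
  edgeSign p q • (opOn (Sum.inl p) (endPauli p q).mat * opOn (Sum.inl q) (endPauli p q).mat *
    faceOp H p q)

/-- The encoded vertex operator. -/
noncomputable def vertOp (H : kagome.Subgraph) (p : H.verts) : Op (Qubit H) :=
  opOn (Sum.inl p) Pauli.Z.mat

theorem edgeSign_sq (p q : ℤ × ℤ) : edgeSign p q * edgeSign p q = 1 := by
  unfold edgeSign; split_ifs <;> simp

theorem edgeSign_symm {p q : ℤ × ℤ} (h : kagome.Adj p q) : edgeSign p q = -edgeSign q p := by
  classical
  obtain ⟨hp, hq⟩ := triOf_spec h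
  have hne : p ≠ q := h.ne
  unfold edgeSign
  rw [triOf_symm q p]
  generalize triOf p q = t at *
  obtain ⟨k, rfl⟩ := hp
  obtain ⟨l, rfl⟩ := hq
  have hs : t.sgn = 1 ∨ t.sgn = -1 := by unfold Tri.sgn; split_ifs <;> simp
  have hinj : ∀ a b, t.corner a = t.corner b ↔ a = b := by
    intro a b
    refine ⟨fun hab => ?_, fun hab => by rw [hab]⟩
    fin_cases a <;> fin_cases b <;> simp [Tri.corner] at hab ⊢ <;> omega
  have hkl : k ≠ l := fun e => hne (by rw [e])
  simp only [hinj]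
  fin_cases k <;> fin_cases l <;> simp at hkl ⊢

theorem endPauli_symm (p q : ℤ × ℤ) : endPauli p q = endPauli q p := by
  unfold endPauli; rw [triOf_symm]

theorem facePauli_symm (p q : ℤ × ℤ) : facePauli p q = facePauli q p := by
  unfold facePauli; simp only [eq_comm]

theorem endPauli_ne_Z (p q : ℤ × ℤ) : endPauli p q ≠ Pauli.Z := by
  unfold endPauli; split_ifs <;> simp

theorem facePauli_ne {t : Tri} {p q r : ℤ × ℤ} (hp : p ∈ t.verts) (hq : q ∈ t.verts)
    (hr : r ∈ t.verts) (hpq : p ≠ q) (hqr : q ≠ r) (hpr : p ≠ r) :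
    facePauli p q ≠ facePauli q r := by
  have hs : t.sgn = 1 ∨ t.sgn = -1 := by unfold Tri.sgn; split_ifs <;> simp
  rw [Tri.mem_verts] at hp hq hr
  rw [Ne, Prod.ext_iff] at hpq hqr hpr
  unfold facePauli
  split_ifs <;> simp <;> omega

variable {H : kagome.Subgraph}

theorem faceOp_symm (p q : H.verts) : faceOp H p q = faceOp H q p := by
  unfold faceOp; rw [facePauli_symm, triOf_symm]

theorem faceOp_sq (p q : H.verts) : faceOp H p q * faceOp H p q = 1 := by
  unfold faceOp; split_ifs
  · exact opOn_sq _ _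
  · simp

theorem skew_inl_face (x p q : H.verts) (A : Matrix (Fin 2) (Fin 2) ℂ) :
    Skew 1 (opOn (Sum.inl x) A) (faceOp H p q) := by
  unfold faceOp; split_ifs
  · exact skew_ne (by simp) _ _
  · exact skew_one_right _

theorem skew_face_inl (x p q : H.verts) (A : Matrix (Fin 2) (Fin 2) ℂ) :
    Skew 1 (faceOp H p q) (opOn (Sum.inl x) A) := by
  unfold faceOp; split_ifs
  · exact skew_ne (by simp) _ _
  · exact skew_one_left _

theorem skew_face_face {p q p' q' : H.verts} (h : triOf p q ≠ triOf p' q') :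
    Skew 1 (faceOp H p q) (faceOp H p' q') := by
  unfold faceOp; split_ifs
  · exact skew_ne (by simpa using h) _ _
  · exact skew_one_right _
  · exact skew_one_left _
  · exact skew_one_left _

theorem skew_inl {x y : H.verts} (h : x ≠ y) (A B : Matrix (Fin 2) (Fin 2) ℂ) :
    Skew 1 (opOn (Sum.inl x : Qubit H) A) (opOn (Sum.inl y) B) :=
  skew_ne (by simpa using h) _ _

theorem skew_edge {s : ℂ} {p q : H.verts} {b : Op (Qubit H)}
    {s₁ s₂ s₃ : ℂ} (h₁ : Skew s₁ (opOn (Sum.inl p) (endPauli p q).mat) b)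
    (h₂ : Skew s₂ (opOn (Sum.inl q) (endPauli p q).mat) b) (h₃ : Skew s₃ (faceOp H p q) b)
    (hs : s₁ * s₂ * s₃ = s) : Skew s (edgeOp H p q) b :=
  hs ▸ (((h₁.mulLeft h₂).mulLeft h₃).smulLeft _)

theorem skew_edge' {s : ℂ} {p q : H.verts} {a : Op (Qubit H)}
    {s₁ s₂ s₃ : ℂ} (h₁ : Skew s₁ a (opOn (Sum.inl p) (endPauli p q).mat))
    (h₂ : Skew s₂ a (opOn (Sum.inl q) (endPauli p q).mat)) (h₃ : Skew s₃ a (faceOp H p q))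
    (hs : s₁ * s₂ * s₃ = s) : Skew s a (edgeOp H p q) :=
  hs ▸ (((h₁.mulRight h₂).mulRight h₃).smulRight _)

theorem edgeOp_symm {p q : H.verts} (h : H.Adj p q) : edgeOp H p q = -edgeOp H q p := by
  have h1 := h.adj_sub
  have hne : p ≠ q := fun e => h1.ne (by rw [e])
  have hc := skew_inl (H := H) hne (endPauli p q).mat (endPauli p q).mat
  rw [Skew, one_smul] at hc
  unfold edgeOp
  rw [edgeSign_symm h1, endPauli_symm q p, faceOp_symm q p, hc, op_neg_smul]

theorem edgeOp_sq {p q : H.verts} (h : H.Adj p q) : edgeOp H p q * edgeOp H p q = 1 := by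
  have h1 := h.adj_sub
  have hne : p ≠ q := fun e => h1.ne (by rw [e])
  have a1 := skew_inl (H := H) hne.symm (endPauli p q).mat (endPauli p q).mat
  have a2 := skew_face_inl (H := H) p p q (endPauli p q).mat
  have a3 := skew_face_inl (H := H) q p q (endPauli p q).mat
  rw [Skew, one_smul] at a1 a2 a3
  have b1 := opOn_sq (Sum.inl p : Qubit H) (endPauli p q)
  have b2 := opOn_sq (Sum.inl q : Qubit H) (endPauli p q)
  have b3 := faceOp_sq p q
  unfold edgeOp
  rw [smul_mul_smul_comm, edgeSign_sq, one_smul]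
  generalize opOn (Sum.inl p : Qubit H) (endPauli p q).mat = x at *
  generalize opOn (Sum.inl q : Qubit H) (endPauli p q).mat = y at *
  generalize faceOp H p q = z at *
  calc x * y * z * (x * y * z) = x * y * (z * x) * y * z := by simp only [mul_assoc]
    _ = x * (y * x) * (z * y) * z := by rw [a2]; simp only [mul_assoc]
    _ = (x * x) * (y * y) * (z * z) := by rw [a1, a3]; simp only [mul_assoc]
    _ = 1 := by rw [b1, b2, b3]; simp

theorem edge_vert {p q x : H.verts} (hp : x ≠ p) (hq : x ≠ q) :
    Skew 1 (edgeOp H p q) (vertOp H x) :=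
  skew_edge (skew_inl hp.symm _ _) (skew_inl hq.symm _ _) (skew_face_inl _ _ _ _) (by norm_num)

theorem edge_vert_anti {p q : H.verts} (h : p ≠ q) :
    Skew (-1) (edgeOp H p q) (vertOp H q) :=
  skew_edge (skew_inl h _ _) (skew_anti _ (endPauli_ne_Z _ _)) (skew_face_inl _ _ _ _)
    (by norm_num)

theorem edge_edge {p q r s : H.verts} (h : H.Adj p q) (h' : H.Adj r s) (h1 : p ≠ r) (h2 : p ≠ s)
    (h3 : q ≠ r) (h4 : q ≠ s) : Skew 1 (edgeOp H p q) (edgeOp H r s) := by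
  have ht : triOf p q ≠ triOf r s := by
    intro e
    obtain ⟨m1, m2⟩ := triOf_spec h.adj_sub
    obtain ⟨m3, m4⟩ := triOf_spec h'.adj_sub
    have n1 := h.adj_sub.ne
    have n2 := h'.adj_sub.ne
    rw [e] at m1 m2
    rw [Tri.mem_verts] at m1 m2 m3 m4
    rw [Ne, Subtype.ext_iff, Prod.ext_iff] at h1 h2 h3 h4
    rw [Ne, Prod.ext_iff] at n1 n2
    omega
  have aux : ∀ x : H.verts, x ≠ r → x ≠ s → ∀ A, Skew 1 (opOn (Sum.inl x) A) (edgeOp H r s) :=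
    fun x hr hs A => skew_edge' (skew_inl hr _ _) (skew_inl hs _ _) (skew_inl_face _ _ _ _)
      (by norm_num)
  exact skew_edge (aux p h1 h2 _) (aux q h3 h4 _)
    (skew_edge' (skew_face_inl _ _ _ _) (skew_face_inl _ _ _ _) (skew_face_face ht)
      (mul_one _)) (by norm_num)

theorem hasFace_of_two (hH : IsLattice H) {t : Tri} {p q r : ℤ × ℤ} (hp : p ∈ t.verts)
    (hq : q ∈ t.verts) (hr : r ∈ t.verts) (hpr : p ≠ r) (h : H.Adj p q) (h' : H.Adj q r) :
    HasFace H (.tri t) := by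
  have h3 := hH.tri_closed t p hp q hq r hr hpr h h'
  have hall : ∀ x ∈ t.verts, x = p ∨ x = q ∨ x = r := by
    have n1 := h.adj_sub.ne
    have n2 := h'.adj_sub.ne
    obtain ⟨a, rfl⟩ := hp
    obtain ⟨b, rfl⟩ := hq
    obtain ⟨c, rfl⟩ := hr
    rintro x ⟨d, rfl⟩
    have hab : a ≠ b := fun e => n1 (by rw [e])
    have hbc : b ≠ c := fun e => n2 (by rw [e])
    have hac : a ≠ c := fun e => hpr (by rw [e])
    have hd : d = a ∨ d = b ∨ d = c := by omega
    rcases hd with rfl | rfl | rfl <;> simp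
  have h1 := h.symm
  have h2 := h'.symm
  have h4 := h3.symm
  intro x hx y hy hxy
  have hne := hxy.ne
  rcases hall x hx with e | e | e <;> rcases hall y hy with e' | e' | e' <;> rw [e, e'] <;>
    first
    | exact absurd (e.trans e'.symm) hne
    | assumption

theorem edge_edge_anti (hH : IsLattice H) {p q r : H.verts} (h : H.Adj p q) (h' : H.Adj q r)
    (hpr : p ≠ r) : Skew (-1) (edgeOp H p q) (edgeOp H q r) := by
  have hpq : p ≠ q := fun e => h.adj_sub.ne (by rw [e])
  have hqr : q ≠ r := fun e => h'.adj_sub.ne (by rw [e])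
  obtain ⟨m1, m2⟩ := triOf_spec h.adj_sub
  obtain ⟨m3, m4⟩ := triOf_spec h'.adj_sub
  have aux : ∀ A, Skew 1 (opOn (Sum.inl p) A) (edgeOp H q r) :=
    fun A => skew_edge' (skew_inl hpq _ _) (skew_inl hpr _ _) (skew_inl_face _ _ _ _)
      (by norm_num)
  by_cases ht : triOf p q = triOf q r
  · have hpr' : (p : ℤ × ℤ) ≠ r := fun e => hpr (Subtype.ext e)
    have hf : HasFace H (.tri (triOf q r)) :=
      hasFace_of_two hH (ht ▸ m1) m3 m4 hpr' h h'
    have hf' : HasFace H (.tri (triOf p q)) := ht ▸ hf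
    have he : endPauli p q = endPauli q r := by unfold endPauli; rw [ht]
    have hface : Skew (-1) (faceOp H p q) (faceOp H q r) := by
      unfold faceOp
      rw [dif_pos hf, dif_pos hf']
      simp only [ht]
      exact skew_anti _ (facePauli_ne (ht ▸ m1) m3 m4 h.adj_sub.ne h'.adj_sub.ne hpr')
    refine skew_edge (aux _) (s₂ := 1) (s₃ := -1) ?_ ?_ (by norm_num)
    · rw [he]
      exact skew_edge' (skew_self _) (skew_inl hqr _ _) (skew_inl_face _ _ _ _) (by norm_num)
    · exact skew_edge' (skew_face_inl _ _ _ _) (skew_face_inl _ _ _ _) hface (by norm_num)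
  · have he : endPauli p q ≠ endPauli q r := by
      intro e
      apply ht
      refine Tri.eq_of_mem m2 m3 ?_
      unfold endPauli at e
      by_cases a : (triOf (p : ℤ × ℤ) q).up = true <;>
        by_cases b : (triOf (q : ℤ × ℤ) r).up = true <;> simp_all
    refine skew_edge (aux _) (s₂ := -1) (s₃ := 1) ?_ ?_ (by norm_num)
    · exact skew_edge' (skew_anti _ he) (skew_inl hqr _ _) (skew_inl_face _ _ _ _)
        (by norm_num)
    · exact skew_edge' (skew_face_inl _ _ _ _) (skew_face_inl _ _ _ _) (skew_face_face ht)
        (by norm_num)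

/-- The encoding on the generators of `M_G`. -/
noncomputable def genOp (H : kagome.Subgraph) : Gen H.coe → (Op (Qubit H))ˣ
  | .phase => opI
  | .vert x => invol (vertOp H x) (opOn_sq _ _)
  | .edge d => invol (edgeOp H d.fst d.snd) (edgeOp_sq d.adj)

theorem genOp_rel (hH : IsLattice H) :
    ∀ w ∈ {w | ∃ l r, Rel H.coe l r ∧ w = l * r⁻¹}, FreeGroup.lift (genOp H) w = 1 := by
  have hI : ((opI ^ 2 : (Op (Qubit H))ˣ) : Op (Qubit H)) = (-1 : ℂ) • 1 := by
    rw [Units.val_pow_eq_pow_val]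
    simp only [opI, smul_pow, Complex.I_sq, one_pow]
  rintro w ⟨l, r, hr, rfl⟩
  rw [map_mul, map_inv, mul_inv_eq_one]
  cases hr with
  | phase_pow =>
    simp only [fI, map_pow, map_one, FreeGroup.lift_apply_of, genOp]
    ext1
    rw [show (4 : ℕ) = 2 * 2 from rfl, pow_mul, Units.val_pow_eq_pow_val, hI]
    simp [smul_pow]
  | phase_central x =>
    simp only [fI, map_mul, FreeGroup.lift_apply_of, genOp]
    ext1
    simp [opI]
  | vert_sq x =>
    simp only [fv, map_pow, map_one, FreeGroup.lift_apply_of, genOp]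
    ext1
    simpa [invol, pow_two, vertOp] using opOn_sq (Sum.inl x : Qubit H) Pauli.Z
  | edge_sq d =>
    simp only [fe, map_pow, map_one, FreeGroup.lift_apply_of, genOp]
    ext1
    simpa [invol, pow_two] using edgeOp_sq d.adj
  | edge_symm d =>
    simp only [fe, fI, map_mul, map_pow, FreeGroup.lift_apply_of, genOp]
    ext1
    rw [Units.val_mul, hI, op_neg_smul, one_smul, op_neg_one_mul]
    simpa [invol] using edgeOp_symm d.adj
  | vert_vert x y h =>
    simp only [fv, map_mul, FreeGroup.lift_apply_of, genOp]
    ext1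
    simpa [invol, Skew, vertOp] using skew_inl (H := H) h Pauli.Z.mat Pauli.Z.mat
  | edge_vert d x h1 h2 =>
    simp only [fe, fv, map_mul, FreeGroup.lift_apply_of, genOp]
    ext1
    simpa [invol, Skew] using edge_vert h1 h2
  | edge_edge d d' h1 h2 h3 h4 =>
    simp only [fe, map_mul, FreeGroup.lift_apply_of, genOp]
    ext1
    simpa [invol, Skew] using edge_edge d.adj d'.adj h1 h2 h3 h4
  | edge_vert_anti d =>
    simp only [fe, fv, fI, map_mul, map_pow, FreeGroup.lift_apply_of, genOp]
    ext1
    rw [Units.val_mul, Units.val_mul, hI, op_neg_smul, one_smul, op_neg_one_mul]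
    have := edge_vert_anti (H := H) d.adj.ne
    rw [Skew, op_neg_smul, one_smul] at this
    simpa [invol] using this
  | edge_edge_anti d d' h1 h2 =>
    simp only [fe, fI, map_mul, map_pow, FreeGroup.lift_apply_of, genOp]
    ext1
    rw [Units.val_mul, Units.val_mul, hI, op_neg_smul, one_smul, op_neg_one_mul]
    have := edge_edge_anti hH d.adj (h1 ▸ d'.adj : H.Adj d.snd d'.snd) h2
    rw [Skew, op_neg_smul, one_smul] at this
    simpa [invol, h1] using this

/-- The Kagome encoding `σ : M_G → L(ℋ)`, where `G` is the lattice `H` as a fermionic graph. -/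
noncomputable def encoding (hH : IsLattice H) : MG H.coe →* (Op (Qubit H))ˣ :=
  PresentedGroup.toGroup (genOp_rel hH)

end Kagome

/-!
Tensoring `E_{pq}` with `i γ_p γ_q`, where the `γ_p` are Majorana operators of a Clifford algebra,
turns the edge operators into commuting involutions, that is, into a homomorphism `T` on the
`𝔽₂`-chains of edges. Around a closed walk from `x` the Majorana factor is `γ_x γ_x = 1`, so the
stabilizer group is a copy of the image under `T` of the cycle space.

A Pauli placed on a corner of a triangle `t` anticommutes with exactly the two sides of `t` that
meet there. Hence, if `T z` commutes with all Paulis, then `z` takes the same value on the three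
sides of every triangle, and is a sum of boundaries of triangular faces; there `T` is `1`, because
the operators around a triangle multiply to `i`. In particular `-1` is not a stabilizer. On the
other hand a finite cycle of the tiling bounds a finite set of faces, all of them faces of the
lattice when it has no holes, so `S ≅ 𝔽₂^HF` and `Δ = TF - HF`.
Euler's formula `V - E + HF + TF = 1` and the count `2 E + TC = 3 TF + 2 V` of the corners of
triangles give both formulas.
-/

namespace Fermi

open Multiplicative

open scoped TensorProduct

/-! ### Elementary abelian groups and their ranks -/

theorem pi_zmod_induction {α : Type*} [Finite α] [DecidableEq α] {n : ℕ} [NeZero n]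
    {p : (α → ZMod n) → Prop} (zero : p 0) (single : ∀ i, p (Pi.single i 1))
    (add : ∀ y z, p y → p z → p (y + z)) (z : α → ZMod n) : p z := by
  have := Fintype.ofFinite α
  let M : AddSubmonoid (α → ZMod n) :=
    { carrier := {z | p z}, zero_mem' := zero, add_mem' := fun {y z} => add y z }
  have single_eq (i : α) : Pi.single i (z i) = (z i).val • (Pi.single i 1 : α → ZMod n) := by
    rw [← Pi.single_smul, nsmul_eq_mul, mul_one, ZMod.natCast_zmod_val]
  change z ∈ M
  rw [← Finset.univ_sum_single z]
  exact sum_mem fun i _ => single_eq i ▸ nsmul_mem (single i : Pi.single i 1 ∈ M) _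

/-- The homomorphism from the cyclic group of order `n` that sends `1` to `u`. -/
def zmodHom {Γ : Type*} [Group Γ] (n : ℕ) (u : Γ) (hu : u ^ n = 1) :
    Multiplicative (ZMod n) →* Γ :=
  AddMonoidHom.toMultiplicativeLeft
    (ZMod.lift n ⟨zmultiplesHom (Additive Γ) (Additive.ofMul u), by
      simp [← ofMul_pow, hu]⟩)

theorem zmodHom_ofAdd_one {Γ : Type*} [Group Γ] (n : ℕ) (u : Γ) (hu : u ^ n = 1) :
    zmodHom n u hu (ofAdd 1) = u := by
  have h := ZMod.lift_coe n ⟨zmultiplesHom (Additive Γ) (Additive.ofMul u), by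
      simp [← ofMul_pow, hu]⟩ 1
  rw [Int.cast_one] at h
  exact (congrArg Additive.toMul h).trans (by simp)

theorem zmodHom_apply {Γ : Type*} [Group Γ] {n : ℕ} [NeZero n] {u : Γ} (hu : u ^ n = 1)
    (z : Multiplicative (ZMod n)) : zmodHom n u hu z = u ^ z.toAdd.val := by
  conv_rhs => rw [← zmodHom_ofAdd_one n u hu, ← map_pow, ← ofAdd_nsmul, nsmul_one,
    ZMod.natCast_zmod_val, ofAdd_toAdd]

section PiHom

variable {ι Γ : Type*} [Fintype ι] [Group Γ] {n : ℕ} [NeZero n] (U : ι → Γ)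

/-- The homomorphism from `(ℤ/n)^ι` that sends the unit vectors to given commuting elements `U i`
of exponent `n`. -/
def piZModHom (hU : ∀ i, U i ^ n = 1) (hc : ∀ i j, Commute (U i) (U j)) :
    Multiplicative (ι → ZMod n) →* Γ :=
  (MonoidHom.noncommPiCoprod (fun i => zmodHom n (U i) (hU i)) fun i j _ x y => by
    simpa only [zmodHom_apply] using (hc i j).pow_pow _ _).comp
    (MulEquiv.funMultiplicative ι (ZMod n)).toMonoidHom

theorem piZModHom_single [DecidableEq ι] (hU : ∀ i, U i ^ n = 1)
    (hc : ∀ i j, Commute (U i) (U j)) (i : ι) :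
    piZModHom U hU hc (ofAdd (Pi.single i 1)) = U i := by
  have single_eq : MulEquiv.funMultiplicative ι (ZMod n) (ofAdd (Pi.single i 1)) =
      Pi.mulSingle i (ofAdd 1) := by
    ext j
    obtain rfl | h := eq_or_ne j i
    · simp
    · simp [h]
  rw [piZModHom, MonoidHom.comp_apply, MulEquiv.toMonoidHom_eq_coe, MonoidHom.coe_coe, single_eq]
  exact (MonoidHom.noncommPiCoprod_mulSingle _ _ _).trans (zmodHom_ofAdd_one ..)

end PiHom

theorem minGen_map_of_injective {X Y : Type} [Group X] [Group Y] {f : X →* Y}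
    (hf : Function.Injective f) (S : Subgroup X) : minGen (S.map f) = minGen S := by
  classical
  unfold minGen
  congr 1
  ext n
  constructor
  · rintro ⟨s, rfl, hs⟩
    have hsub : (s : Set Y) ⊆ Set.range f := fun y hy => by
      obtain ⟨x, -, rfl⟩ := hs ▸ Subgroup.subset_closure hy
      exact ⟨x, rfl⟩
    obtain ⟨t, rfl⟩ : ∃ t : Finset X, t.map ⟨f, hf⟩ = s := by
      obtain ⟨t, -, ht⟩ := Finset.subset_set_image_iff.1 (Set.image_univ ▸ hsub)
      exact ⟨t, by rw [Finset.map_eq_image]; exact ht⟩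
    refine ⟨t, (t.card_map _).symm, Subgroup.map_injective hf ?_⟩
    rw [MonoidHom.map_closure, ← hs, Finset.coe_map]
    rfl
  · rintro ⟨s, rfl, rfl⟩
    refine ⟨s.map ⟨f, hf⟩, s.card_map _, ?_⟩
    rw [MonoidHom.map_closure, Finset.coe_map]
    rfl

theorem minGen_top_multiplicative_pi_zmod (α : Type) [Fintype α] (p : ℕ) [Fact p.Prime] :
    minGen (⊤ : Subgroup (Multiplicative (α → ZMod p))) = Fintype.card α := by
  classical
  let basis : α ↪ Multiplicative (α → ZMod p) :=
    ⟨fun i => ofAdd (Pi.single i 1), fun i j h => by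
      by_contra hij
      simpa [hij] using congrFun (ofAdd.injective h) i⟩
  have generates : Subgroup.closure (Finset.univ.map basis : Set (Multiplicative (α → ZMod p))) =
      ⊤ := by
    refine (Subgroup.eq_top_iff' _).2 fun z => ?_
    rw [← ofAdd_toAdd z]
    induction z.toAdd using pi_zmod_induction with
    | zero => exact one_mem _
    | single i =>
      exact Subgroup.subset_closure
        (Finset.mem_coe.2 (Finset.mem_map_of_mem basis (Finset.mem_univ i)))
    | add y z hy hz => exact mul_mem hy hz
  have card_le (s : Finset (Multiplicative (α → ZMod p)))
      (hs : Subgroup.closure (s : Set (Multiplicative (α → ZMod p))) = ⊤) :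
      Fintype.card α ≤ s.card := by
    let t : Finset (α → ZMod p) := s.map toAdd.toEmbedding
    have closure_le : Subgroup.closure (s : Set (Multiplicative (α → ZMod p))) ≤
        (Submodule.span (ZMod p) (t : Set (α → ZMod p))).toAddSubgroup.toSubgroup := by
      refine (Subgroup.closure_le _).2 fun x hx => ?_
      change x.toAdd ∈ Submodule.span (ZMod p) (t : Set (α → ZMod p))
      exact Submodule.subset_span (Finset.mem_coe.2 (Finset.mem_map_of_mem _ hx))
    have spans : Submodule.span (ZMod p) (t : Set (α → ZMod p)) = ⊤ :=
      (Submodule.eq_top_iff').2 fun z => closure_le (hs ▸ Subgroup.mem_top (ofAdd z))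
    have h := finrank_span_finset_le_card (R := ZMod p) t
    rwa [Set.finrank, spans, finrank_top, Module.finrank_fintype_fun_eq_card,
      Finset.card_map] at h
  refine le_antisymm (Nat.sInf_le ⟨_, Finset.card_map _, generates⟩)
    (le_csInf ⟨_, _, rfl, generates⟩ ?_)
  rintro _ ⟨s, rfl, hs⟩
  exact card_le s hs

/-! ### Edge operators and Majorana operators -/

/-- The commutation relations satisfied by the images of the directed edges under a representation
of `M_G`. -/
structure EdgeRel {V A : Type*} [Ring A] (G : SimpleGraph V) (E : V → V → A) : Prop where
  sq : ∀ {p q}, G.Adj p q → E p q * E p q = 1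
  symm : ∀ {p q}, G.Adj p q → E p q = -E q p
  comm : ∀ {p q r s}, G.Adj p q → G.Adj r s → p ≠ r → p ≠ s → q ≠ r → q ≠ s →
    E p q * E r s = E r s * E p q
  anti : ∀ {p q r}, G.Adj p q → G.Adj q r → p ≠ r → E p q * E q r = -(E q r * E p q)

/-- Commuting involutions attached to the undirected edges of a graph, written as a symmetric
function of the two ends. -/
structure CommEdgeRel {V B : Type*} [Ring B] (G : SimpleGraph V) (F : V → V → B) : Prop where
  sq : ∀ {p q}, G.Adj p q → F p q * F p q = 1
  symm : ∀ {p q}, G.Adj p q → F p q = F q p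
  comm : ∀ {p q r s}, G.Adj p q → G.Adj r s → F p q * F r s = F r s * F p q

theorem EdgeRel.tmul {V A A' : Type*} [Ring A] [Algebra ℂ A] [Ring A'] [Algebra ℂ A']
    {G : SimpleGraph V} {E : V → V → A} {E' : V → V → A'} (hE : EdgeRel G E)
    (hE' : EdgeRel G E') : CommEdgeRel G fun p q => E p q ⊗ₜ[ℂ] E' p q := by
  have symm {p q : V} (h : G.Adj p q) : E p q ⊗ₜ[ℂ] E' p q = E q p ⊗ₜ E' q p := by
    rw [hE.symm h, hE'.symm h, TensorProduct.neg_tmul, TensorProduct.tmul_neg, neg_neg]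
  have comm_adj {p q r : V} (h : G.Adj p q) (h' : G.Adj q r) :
      (E p q ⊗ₜ[ℂ] E' p q) * (E q r ⊗ₜ E' q r) = (E q r ⊗ₜ E' q r) * (E p q ⊗ₜ E' p q) := by
    obtain rfl | hpr := eq_or_ne p r
    · rw [symm h]
    · rw [Algebra.TensorProduct.tmul_mul_tmul, hE.anti h h' hpr, hE'.anti h h' hpr,
        TensorProduct.neg_tmul, TensorProduct.tmul_neg, neg_neg,
        Algebra.TensorProduct.tmul_mul_tmul]
  refine ⟨fun h => ?_, symm, fun {p q r s} h h' => ?_⟩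
  · rw [Algebra.TensorProduct.tmul_mul_tmul, hE.sq h, hE'.sq h, Algebra.TensorProduct.one_def]
  · obtain rfl | hqr := eq_or_ne q r
    · exact comm_adj h h'
    obtain rfl | hqs := eq_or_ne q s
    · simpa only [symm h'] using comm_adj h h'.symm
    obtain rfl | hpr := eq_or_ne p r
    · simpa only [symm h] using comm_adj h.symm h'
    obtain rfl | hps := eq_or_ne p s
    · simpa only [symm h, symm h'] using comm_adj h.symm h'.symm
    · rw [Algebra.TensorProduct.tmul_mul_tmul, Algebra.TensorProduct.tmul_mul_tmul,
        hE.comm h h' hpr hps hqr hqs, hE'.comm h h' hpr hps hqr hqs]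

section Majorana

variable {V : Type*} [Fintype V]

variable (V) in
/-- The algebra generated by one Majorana operator for every element of `V`. -/
abbrev MajoranaAlgebra : Type _ :=
  CliffordAlgebra (QuadraticMap.weightedSumSquares ℂ fun _ : V => (1 : ℂ))

open Classical in
/-- The Majorana operators: pairwise anticommuting involutions. -/
noncomputable def majorana (p : V) : MajoranaAlgebra V :=
  CliffordAlgebra.ι _ (Pi.single p 1)

theorem majorana_mul_self (p : V) : majorana p * majorana p = 1 := by
  classical
  rw [majorana, CliffordAlgebra.ι_sq_scalar]
  simp [QuadraticMap.weightedSumSquares_apply, Pi.single_apply]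

theorem majorana_mul_comm {p q : V} (h : p ≠ q) :
    majorana p * majorana q = -(majorana q * majorana p) := by
  classical
  apply CliffordAlgebra.ι_mul_ι_comm_of_isOrtho
  rw [QuadraticMap.isOrtho_def]
  simp only [QuadraticMap.weightedSumSquares_apply, ← Finset.sum_add_distrib]
  refine Finset.sum_congr rfl fun i _ => ?_
  obtain rfl | hi := eq_or_ne i p
  · simp [h]
  · simp [Pi.single_apply, hi]

theorem majorana_mul_mul_mul (p q r : V) :
    majorana p * majorana q * (majorana q * majorana r) = majorana p * majorana r := by
  rw [mul_assoc, ← mul_assoc (majorana q), majorana_mul_self, one_mul]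

/-- The hermitian product of two Majorana operators. -/
noncomputable def majoranaPair (p q : V) : MajoranaAlgebra V :=
  Complex.I • (majorana p * majorana q)

theorem majorana_mul_pair_comm {p q r s : V} (hpr : p ≠ r) (hps : p ≠ s) (hqr : q ≠ r)
    (hqs : q ≠ s) :
    majorana p * majorana q * (majorana r * majorana s) =
      majorana r * majorana s * (majorana p * majorana q) := by
  have move {x : V} (hxr : x ≠ r) (hxs : x ≠ s) :
      Commute (majorana x) (majorana r * majorana s) := by
    rw [commute_iff_eq, ← mul_assoc, majorana_mul_comm hxr, neg_mul, mul_assoc,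
      majorana_mul_comm hxs, mul_neg, neg_neg, mul_assoc]
  exact (move hpr hps).mul_left (move hqr hqs)

theorem edgeRel_majoranaPair (G : SimpleGraph V) : EdgeRel G (majoranaPair (V := V)) where
  sq {p q} h := by
    rw [majoranaPair, smul_mul_smul_comm, Complex.I_mul_I]
    nth_rw 2 [majorana_mul_comm h.ne]
    rw [mul_neg, majorana_mul_mul_mul, majorana_mul_self, neg_smul, one_smul, neg_neg]
  symm h := by rw [majoranaPair, majorana_mul_comm h.ne, smul_neg, majoranaPair]
  comm _ _ hpr hps hqr hqs := by
    rw [majoranaPair, majoranaPair, smul_mul_smul_comm, smul_mul_smul_comm,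
      majorana_mul_pair_comm hpr hps hqr hqs]
  anti {p q r} h h' hpr := by
    have swapped : majorana q * majorana r * (majorana p * majorana q) =
        majorana r * majorana p := by
      rw [majorana_mul_comm h'.ne, majorana_mul_comm h.ne, neg_mul_neg, majorana_mul_mul_mul]
    rw [majoranaPair, majoranaPair, smul_mul_smul_comm, smul_mul_smul_comm, majorana_mul_mul_mul,
      swapped, majorana_mul_comm hpr, smul_neg]

end Majorana

/-! ### The mod 2 cycle space -/

/-- A labelling of the edges of a graph by an index set, which also directs every edge. -/
structure EdgeLabelling {V : Type*} (G : SimpleGraph V) (ι : Type*) where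
  dart : ι → G.Dart
  existsUnique_edge : ∀ e ∈ G.edgeSet, ∃! i, (dart i).edge = e

namespace EdgeLabelling

variable {V ι : Type*} {G : SimpleGraph V} (ℓ : EdgeLabelling G ι)

theorem edge_injective : Function.Injective fun i => (ℓ.dart i).edge := fun i _ h =>
  (ℓ.existsUnique_edge _ (ℓ.dart i).edge_mem).unique rfl h.symm

open Classical in
/-- The mod 2 chain consisting of a single edge. -/
noncomputable def edgeChain (e : Sym2 V) : ι → ZMod 2 :=
  fun i => if (ℓ.dart i).edge = e then 1 else 0

theorem edgeChain_edge [DecidableEq ι] (i : ι) :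
    ℓ.edgeChain (ℓ.dart i).edge = Pi.single i 1 := by
  ext j
  simp only [edgeChain, Pi.single_apply, ℓ.edge_injective.eq_iff]

/-- The mod 2 chain of the edges of a walk, counted with multiplicity. -/
noncomputable def chain {x y : V} (w : G.Walk x y) : ι → ZMod 2 :=
  (w.edges.map ℓ.edgeChain).sum

theorem chain_nil (x : V) : ℓ.chain (.nil : G.Walk x x) = 0 := rfl

theorem chain_cons {x y z : V} (h : G.Adj x y) (w : G.Walk y z) :
    ℓ.chain (.cons h w) = ℓ.edgeChain s(x, y) + ℓ.chain w := by
  simp [chain]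

theorem chain_append {x y z : V} (w : G.Walk x y) (w' : G.Walk y z) :
    ℓ.chain (w.append w') = ℓ.chain w + ℓ.chain w' := by
  simp [chain]

theorem chain_reverse {x y : V} (w : G.Walk x y) : ℓ.chain w.reverse = ℓ.chain w := by
  simp [chain, List.sum_reverse]

variable [Fintype ι] [DecidableEq V]

/-- The mod 2 boundary map from edges to vertices. -/
noncomputable def boundary : (ι → ZMod 2) →ₗ[ZMod 2] (V → ZMod 2) :=
  Fintype.linearCombination (ZMod 2) fun i =>
    Pi.single (ℓ.dart i).fst 1 + Pi.single (ℓ.dart i).snd 1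

/-- The mod 2 cycle space. -/
noncomputable def cycleSpace : Submodule (ZMod 2) (ι → ZMod 2) :=
  LinearMap.ker ℓ.boundary

theorem boundary_single [DecidableEq ι] (i : ι) :
    ℓ.boundary (Pi.single i 1) = Pi.single (ℓ.dart i).fst 1 + Pi.single (ℓ.dart i).snd 1 := by
  rw [boundary, Fintype.linearCombination_apply_single, one_smul]

theorem boundary_edgeChain {p q : V} (h : G.Adj p q) :
    ℓ.boundary (ℓ.edgeChain s(p, q)) = Pi.single p 1 + Pi.single q 1 := by
  classical
  obtain ⟨i, hi, -⟩ := ℓ.existsUnique_edge s(p, q) h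
  rw [← hi, edgeChain_edge, boundary_single]
  obtain ⟨h₁, h₂⟩ | ⟨h₁, h₂⟩ := Sym2.eq_iff.1 hi
  · rw [h₁, h₂]
  · rw [h₁, h₂, add_comm]

theorem boundary_chain {x y : V} (w : G.Walk x y) :
    ℓ.boundary (ℓ.chain w) = Pi.single x 1 + Pi.single y 1 := by
  induction w with
  | nil => rw [chain_nil, map_zero, ZModModule.add_self]
  | cons h w ih =>
    rw [chain_cons, map_add, boundary_edgeChain ℓ h, ih, ZModModule.add_add_add_cancel]

theorem chain_mem_cycleSpace {x : V} (w : G.Walk x x) : ℓ.chain w ∈ ℓ.cycleSpace := by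
  rw [cycleSpace, LinearMap.mem_ker, boundary_chain, ZModModule.add_self]

theorem cycleSpace_le_span_chain [Finite V] (hG : G.Connected) :
    ℓ.cycleSpace ≤ Submodule.span (ZMod 2) {z | ∃ (x : V) (w : G.Walk x x), ℓ.chain w = z} := by
  classical
  have := Fintype.ofFinite V
  obtain ⟨r⟩ := hG.nonempty
  let path (x : V) : G.Walk r x := (hG.preconnected r x).some
  let loop (i : ι) : G.Walk r r :=
    (path (ℓ.dart i).fst).append (.cons (ℓ.dart i).adj (path (ℓ.dart i).snd).reverse)
  let cone : (V → ZMod 2) →ₗ[ZMod 2] (ι → ZMod 2) :=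
    Fintype.linearCombination (ZMod 2) fun x => ℓ.chain (path x)
  have cone_single (x : V) : cone (Pi.single x 1) = ℓ.chain (path x) := by
    rw [Fintype.linearCombination_apply_single, one_smul]
  have chain_loop (i : ι) :
      ℓ.chain (loop i) = Pi.single i 1 + cone (ℓ.boundary (Pi.single i 1)) := by
    have edge_eq : ℓ.edgeChain s((ℓ.dart i).fst, (ℓ.dart i).snd) = Pi.single i 1 :=
      ℓ.edgeChain_edge i
    rw [boundary_single, map_add, cone_single, cone_single, chain_append, chain_cons,
      chain_reverse, edge_eq, add_left_comm]
  have sum_loops : Fintype.linearCombination (ZMod 2) (fun i => ℓ.chain (loop i)) =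
      LinearMap.id + cone ∘ₗ ℓ.boundary :=
    LinearMap.pi_ext' fun i => LinearMap.ext_ring <| by
      simpa only [LinearMap.comp_apply, LinearMap.add_apply, LinearMap.id_apply,
        LinearMap.single_apply, Fintype.linearCombination_apply_single, one_smul] using chain_loop i
  intro z hz
  have z_eq := LinearMap.congr_fun sum_loops z
  rw [LinearMap.add_apply, LinearMap.comp_apply, LinearMap.mem_ker.1 hz, map_zero, add_zero,
    LinearMap.id_apply, Fintype.linearCombination_apply] at z_eq
  rw [← z_eq]
  exact sum_mem fun i _ => Submodule.smul_mem _ _ (Submodule.subset_span ⟨r, loop i, rfl⟩)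

theorem range_boundary [Fintype V] (hG : G.Connected) :
    LinearMap.range ℓ.boundary =
      LinearMap.ker (∑ x, LinearMap.proj x : (V → ZMod 2) →ₗ[ZMod 2] ZMod 2) := by
  classical
  obtain ⟨r⟩ := hG.nonempty
  apply le_antisymm
  · rw [boundary, Fintype.range_linearCombination, Submodule.span_le]
    rintro _ ⟨i, rfl⟩
    simp [Finset.sum_add_distrib, ZModModule.add_self]
  · intro y hy
    have sum_eq : ∑ x, y x = 0 := by
      simpa only [LinearMap.mem_ker, LinearMap.sum_apply, LinearMap.proj_apply] using hy
    have y_eq : ∑ x, y x • (Pi.single r 1 + Pi.single x 1 : V → ZMod 2) = y := by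
      simp only [smul_add, Finset.sum_add_distrib, ← Finset.sum_smul, sum_eq, zero_smul, zero_add]
      ext j
      simp [Finset.sum_apply, Pi.single_apply]
    rw [← y_eq]
    exact sum_mem fun x _ =>
      Submodule.smul_mem _ _ ⟨_, boundary_chain ℓ (hG.preconnected r x).some⟩

theorem finrank_cycleSpace_add_card [Fintype V] (hG : G.Connected) :
    Module.finrank (ZMod 2) ℓ.cycleSpace + Fintype.card V = Fintype.card ι + 1 := by
  let total : (V → ZMod 2) →ₗ[ZMod 2] ZMod 2 := ∑ x, LinearMap.proj x
  obtain ⟨r⟩ := hG.nonempty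
  have range_total : LinearMap.range total = ⊤ :=
    LinearMap.range_eq_top.2 fun c => ⟨Pi.single r c, by simp [total]⟩
  have range_eq : LinearMap.range ℓ.boundary = LinearMap.ker total := range_boundary ℓ hG
  have rank_boundary := LinearMap.finrank_range_add_finrank_ker ℓ.boundary
  have rank_total := LinearMap.finrank_range_add_finrank_ker total
  rw [range_eq, Module.finrank_fintype_fun_eq_card] at rank_boundary
  rw [range_total, finrank_top, Module.finrank_self, Module.finrank_fintype_fun_eq_card]
    at rank_total
  rw [cycleSpace]
  lia

end EdgeLabelling

/-! ### Closed walks and the twisted homomorphism -/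

section EdgeHom

variable {V ι B : Type*} [Ring B] [Fintype ι] {G : SimpleGraph V} (ℓ : EdgeLabelling G ι)
  {F : V → V → B} (hF : CommEdgeRel G F)

/-- The homomorphism from mod 2 chains that sends every edge to its commuting involution. -/
def edgeHom : Multiplicative (ι → ZMod 2) →* Bˣ :=
  piZModHom
    (fun i => ⟨F (ℓ.dart i).fst (ℓ.dart i).snd, F (ℓ.dart i).fst (ℓ.dart i).snd,
      hF.sq (ℓ.dart i).adj, hF.sq (ℓ.dart i).adj⟩)
    (fun i => Units.ext ((pow_two _).trans (hF.sq (ℓ.dart i).adj)))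
    (fun i j => Units.ext (hF.comm (ℓ.dart i).adj (ℓ.dart j).adj))

theorem edgeHom_single [DecidableEq ι] (i : ι) :
    (edgeHom ℓ hF (ofAdd (Pi.single i 1)) : B) = F (ℓ.dart i).fst (ℓ.dart i).snd :=
  congrArg Units.val (piZModHom_single ..)

theorem edgeHom_edgeChain {p q : V} (h : G.Adj p q) :
    (edgeHom ℓ hF (ofAdd (ℓ.edgeChain s(p, q))) : B) = F p q := by
  classical
  obtain ⟨i, hi, -⟩ := ℓ.existsUnique_edge s(p, q) h
  rw [← hi, ℓ.edgeChain_edge, edgeHom_single]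
  obtain ⟨h₁, h₂⟩ | ⟨h₁, h₂⟩ := Sym2.eq_iff.1 hi
  · rw [h₁, h₂]
  · rw [h₁, h₂, hF.symm h.symm]

theorem edgeHom_chain {x y : V} (w : G.Walk x y) :
    (edgeHom ℓ hF (ofAdd (ℓ.chain w)) : B) = (w.darts.map fun d => F d.fst d.snd).prod := by
  induction w with
  | nil => rw [ℓ.chain_nil, ofAdd_zero, map_one, Units.val_one]; rfl
  | cons h w ih =>
    rw [ℓ.chain_cons, ofAdd_add, map_mul, Units.val_mul, edgeHom_edgeChain ℓ hF h, ih]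
    rfl

end EdgeHom

section WalkOp

variable {V A : Type*} [Ring A] [Algebra ℂ A] {G : SimpleGraph V}

/-- The operator `iⁿ E_{x₀x₁} ⋯ E_{xₙ₋₁xₙ}` of a walk. -/
noncomputable def walkOp (E : V → V → A) {x y : V} (w : G.Walk x y) : A :=
  Complex.I ^ w.length • (w.darts.map fun d => E d.fst d.snd).prod

theorem isUnit_walkOp {E : V → V → A} (hE : EdgeRel G E) {x y : V} (w : G.Walk x y) :
    IsUnit (walkOp E w) := by
  refine IsUnit.smul (Units.mk0 Complex.I Complex.I_ne_zero ^ w.length)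
    (list_prod_mem (S := IsUnit.submonoid A) fun a ha => ?_)
  obtain ⟨d, -, rfl⟩ := List.mem_map.1 ha
  exact ⟨⟨_, _, hE.sq d.adj, hE.sq d.adj⟩, rfl⟩

theorem prod_tmul_majoranaPair [Fintype V] (E : V → V → A) {x y : V} (w : G.Walk x y) :
    (w.darts.map fun d => E d.fst d.snd ⊗ₜ[ℂ] majoranaPair d.fst d.snd).prod =
      walkOp E w ⊗ₜ (majorana x * majorana y) := by
  induction w with
  | nil =>
    rw [walkOp, majorana_mul_self, SimpleGraph.Walk.length_nil, pow_zero, one_smul]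
    rfl
  | cons h w ih =>
    rw [SimpleGraph.Walk.darts_cons, List.map_cons, List.prod_cons, ih,
      Algebra.TensorProduct.tmul_mul_tmul, majoranaPair, smul_mul_assoc, majorana_mul_mul_mul,
      TensorProduct.tmul_smul, TensorProduct.smul_tmul', walkOp, walkOp,
      SimpleGraph.Walk.length_cons, SimpleGraph.Walk.darts_cons, List.map_cons, List.prod_cons,
      mul_smul_comm, smul_smul, pow_succ']

/-- The group generated by the operators of all closed walks. -/
def walkGroup (G : SimpleGraph V) (E : V → V → A) : Subgroup Aˣ :=
  Subgroup.closure {u | ∃ (x : V) (w : G.Walk x x), (u : A) = walkOp E w}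

end WalkOp

/-- The nontrivial character `c ↦ (-1)ᶜ` of `ℤ/2`. -/
noncomputable def paritySign : AddChar (ZMod 2) ℂ :=
  AddChar.zmodChar 2 (by norm_num : (-1 : ℂ) ^ 2 = 1)

theorem paritySign_one : paritySign 1 = -1 := by
  rw [paritySign, AddChar.zmodChar_apply]
  exact pow_one _

theorem paritySign_eq_one {c : ZMod 2} : paritySign c = 1 ↔ c = 0 := by
  obtain rfl | rfl : c = 0 ∨ c = 1 := by decide +revert
  · exact iff_of_true paritySign.map_zero_eq_one rfl
  · exact iff_of_false (paritySign_one.trans_ne (by norm_num)) one_ne_zero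

section Twist

variable {V ι A : Type*} [Fintype V] [Fintype ι] [Ring A] [Algebra ℂ A] {G : SimpleGraph V}

variable (V A) in
/-- The inclusion of `A` into its tensor product with the Majorana algebra, on units. -/
noncomputable def inclMajorana : Aˣ →* (A ⊗[ℂ] MajoranaAlgebra V)ˣ :=
  Units.map (Algebra.TensorProduct.includeLeft : A →ₐ[ℂ] A ⊗[ℂ] MajoranaAlgebra V)

theorem inclMajorana_injective : Function.Injective (inclMajorana V A) :=
  Units.map_injective <|
    Algebra.TensorProduct.includeLeft_injective (S := ℂ)
      (algebraMap ℂ (MajoranaAlgebra V)).injective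

variable (ℓ : EdgeLabelling G ι) {E : V → V → A} (hE : EdgeRel G E)

/-- Tensoring the edge operators with Majorana pairs makes them commute, and so turns them into a
homomorphism from mod 2 chains. -/
noncomputable def twistHom : Multiplicative (ι → ZMod 2) →* (A ⊗[ℂ] MajoranaAlgebra V)ˣ :=
  edgeHom ℓ (hE.tmul (edgeRel_majoranaPair G))

theorem twistHom_chain {x : V} (w : G.Walk x x) :
    (twistHom ℓ hE (ofAdd (ℓ.chain w)) : A ⊗[ℂ] MajoranaAlgebra V) = walkOp E w ⊗ₜ 1 := by
  rw [twistHom, edgeHom_chain, prod_tmul_majoranaPair, majorana_mul_self]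

theorem twistHom_chain_eq_inclMajorana {x : V} {w : G.Walk x x} {u : Aˣ}
    (hu : (u : A) = walkOp E w) :
    twistHom ℓ hE (ofAdd (ℓ.chain w)) = inclMajorana V A u := by
  rw [Units.ext_iff, twistHom_chain, ← hu]
  rfl

variable {ℓ hE}

theorem twistHom_mul_tmul_one {X : A} {c : ι → ZMod 2}
    (hX : ∀ i, E (ℓ.dart i).fst (ℓ.dart i).snd * X =
      paritySign (c i) • (X * E (ℓ.dart i).fst (ℓ.dart i).snd)) (z : ι → ZMod 2) :
    (twistHom ℓ hE (ofAdd z) : A ⊗[ℂ] MajoranaAlgebra V) * (X ⊗ₜ 1) =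
      paritySign (z ⬝ᵥ c) • (X ⊗ₜ 1 * (twistHom ℓ hE (ofAdd z) : A ⊗[ℂ] MajoranaAlgebra V)) := by
  classical
  induction z using pi_zmod_induction with
  | zero => simp
  | single i =>
    rw [single_one_dotProduct, twistHom, edgeHom_single, Algebra.TensorProduct.tmul_mul_tmul,
      Algebra.TensorProduct.tmul_mul_tmul, hX, mul_one, one_mul, TensorProduct.smul_tmul']
  | add y z hy hz =>
    rw [ofAdd_add, map_mul, Units.val_mul, mul_assoc, hz, mul_smul_comm, ← mul_assoc, hy,
      smul_mul_assoc, smul_smul, mul_assoc, add_dotProduct, AddChar.map_add_eq_mul, mul_comm]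

theorem dotProduct_eq_zero_of_commute [Nontrivial A] {X : Aˣ} {c : ι → ZMod 2}
    (hX : ∀ i, E (ℓ.dart i).fst (ℓ.dart i).snd * X =
      paritySign (c i) • ((X : A) * E (ℓ.dart i).fst (ℓ.dart i).snd)) {z : ι → ZMod 2}
    (hz : Commute (twistHom ℓ hE (ofAdd z)) (inclMajorana V A X)) : z ⬝ᵥ c = 0 := by
  have : Nontrivial (A ⊗[ℂ] MajoranaAlgebra V) :=
    (Algebra.TensorProduct.includeLeft_injective (S := ℂ)
      (algebraMap ℂ (MajoranaAlgebra V)).injective).nontrivial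
  let u := inclMajorana V A X * twistHom ℓ hE (ofAdd z)
  have skew : (1 : ℂ) • (u : A ⊗[ℂ] MajoranaAlgebra V) = paritySign (z ⬝ᵥ c) • (u : A ⊗[ℂ] _) := by
    refine Eq.trans ?_ (twistHom_mul_tmul_one hX z)
    rw [one_smul]
    exact congrArg Units.val hz.eq.symm
  exact paritySign_eq_one.1 (smul_left_injective ℂ u.ne_zero skew).symm

variable (ℓ hE) [DecidableEq V]

theorem map_walkGroup (hG : G.Connected) : (walkGroup G E).map (inclMajorana V A) =
    ℓ.cycleSpace.toAddSubgroup.toSubgroup.map (twistHom ℓ hE) := by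
  apply le_antisymm
  · rw [walkGroup, MonoidHom.map_closure, Subgroup.closure_le]
    rintro _ ⟨u, ⟨x, w, hu⟩, rfl⟩
    exact ⟨_, ℓ.chain_mem_cycleSpace w, twistHom_chain_eq_inclMajorana ℓ hE hu⟩
  · let image : AddSubgroup (ι → ZMod 2) :=
      (((walkGroup G E).map (inclMajorana V A)).comap (twistHom ℓ hE)).toAddSubgroup'
    suffices ℓ.cycleSpace ≤ AddSubgroup.toZModSubmodule 2 image from
      Subgroup.map_le_iff_le_comap.2 this
    refine (ℓ.cycleSpace_le_span_chain hG).trans (Submodule.span_le.2 ?_)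
    rintro _ ⟨x, w, rfl⟩
    obtain ⟨u, hu⟩ := isUnit_walkOp hE w
    exact ⟨u, Subgroup.subset_closure ⟨x, w, hu⟩, (twistHom_chain_eq_inclMajorana ℓ hE hu).symm⟩

end Twist

end Fermi

namespace Kagome

open Fermi Multiplicative

open scoped TensorProduct

variable {H : kagome.Subgraph}

/-! ### Corners and sides of the faces of the Kagome tiling -/

theorem fin_three_add_one_ne_add_two (k : Fin 3) : k + 1 ≠ k + 2 := by decide +revert

theorem fin_three_add_one_eq_iff (k a : Fin 3) : k + 1 = a ↔ a + 2 = k := by decide +revert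

theorem fin_three_add_two_eq_iff (k a : Fin 3) : k + 2 = a ↔ a + 1 = k := by decide +revert

theorem fin_three_eq_or_of_ne {a k : Fin 3} (h : a ≠ k) : a = k + 1 ∨ a = k + 2 := by
  decide +revert

theorem fin_three_exists_of_ne {a b : Fin 3} (h : a ≠ b) :
    ∃ k, a = k + 1 ∧ b = k + 2 ∨ a = k + 2 ∧ b = k + 1 := by
  decide +revert

namespace Tri

variable (t : Tri) (a k : Fin 3)

theorem sgn_eq_one_or : t.sgn = 1 ∨ t.sgn = -1 := by
  unfold sgn
  split <;> simp

theorem corner_mem : t.corner a ∈ t.verts := ⟨a, rfl⟩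

theorem corner_injective : Function.Injective t.corner := fun a b h => by
  obtain hs | hs := t.sgn_eq_one_or <;> fin_cases a <;> fin_cases b <;>
    simp [corner, hs] at h ⊢

theorem isSite_corner : IsSite (t.corner a) := by
  obtain hs | hs := t.sgn_eq_one_or <;> fin_cases a <;>
    simp [IsSite, corner, hs]

theorem adj_side : kagome.Adj (t.corner (k + 1)) (t.corner (k + 2)) := by
  refine ⟨t.isSite_corner _, t.isSite_corner _, ![2, 4, 0] k + if t.up then 0 else 3, ?_⟩
  obtain ⟨u, m, n⟩ := t
  cases u <;> fin_cases k <;> simp [corner, sgn, unitVec]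

theorem adj_corner {a b : Fin 3} (h : a ≠ b) : kagome.Adj (t.corner a) (t.corner b) := by
  obtain ⟨k, ⟨rfl, rfl⟩ | ⟨rfl, rfl⟩⟩ := fin_three_exists_of_ne h
  · exact t.adj_side k
  · exact (t.adj_side k).symm

theorem corner_side_ne : t.corner (k + 1) ≠ t.corner (k + 2) := (t.adj_side k).ne

/-- The triangle opposite to `t` at its corner `a`; this is also corner number `a` of the opposite
triangle. -/
def opp : Tri :=
  ⟨!t.up, t.m + (![0, t.sgn, 0] : Fin 3 → ℤ) a, t.n + (![0, 0, t.sgn] : Fin 3 → ℤ) a⟩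

theorem opp_ne : t.opp a ≠ t := fun h =>
  Bool.not_ne_self t.up (congrArg up h)

theorem corner_opp : (t.opp a).corner a = t.corner a := by
  obtain ⟨u, m, n⟩ := t
  cases u <;> fin_cases a <;> simp [corner, opp, sgn] <;> ring

variable {t a} in
theorem corner_eq_iff {t' : Tri} {b : Fin 3} :
    t'.corner b = t.corner a ↔ b = a ∧ (t' = t ∨ t' = t.opp a) := by
  constructor
  · intro h
    obtain hu | hu := Bool.eq_or_eq_not t'.up t.up
    · obtain rfl : t' = t := eq_of_mem (h ▸ t'.corner_mem b) (t.corner_mem a) hu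
      exact ⟨t'.corner_injective h, Or.inl rfl⟩
    · rw [← t.corner_opp a] at h
      obtain rfl : t' = t.opp a := eq_of_mem (h ▸ t'.corner_mem b) ((t.opp a).corner_mem a) hu
      exact ⟨(t.opp a).corner_injective h, Or.inr rfl⟩
  · rintro ⟨rfl, rfl | rfl⟩
    · rfl
    · exact t.corner_opp b

end Tri

theorem exists_corner {p : ℤ × ℤ} (hp : IsSite p) (u : Bool) :
    ∃ (t : Tri) (a : Fin 3), t.up = u ∧ t.corner a = p := by
  have exists_up : ∃ (m n : ℤ) (a : Fin 3), (Tri.mk true m n).corner a = p := by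
    simp only [IsSite, Int.even_iff] at hp
    by_cases h₁ : p.1 % 2 = 0
    · exact ⟨p.1 / 2 - 1, p.2 / 2, 1, by ext <;> simp [Tri.corner, Tri.sgn] <;> lia⟩
    by_cases h₂ : p.2 % 2 = 0
    · exact ⟨p.1 / 2, p.2 / 2 - 1, 2, by ext <;> simp [Tri.corner, Tri.sgn] <;> lia⟩
    · exact ⟨p.1 / 2, p.2 / 2, 0, by ext <;> simp [Tri.corner] <;> lia⟩
  obtain ⟨m, n, a, rfl⟩ := exists_up
  cases u
  · exact ⟨_, a, rfl, Tri.corner_opp _ a⟩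
  · exact ⟨_, a, rfl, rfl⟩

theorem exists_side {p q : ℤ × ℤ} (h : kagome.Adj p q) :
    ∃ (t : Tri) (k : Fin 3), s(t.corner (k + 1), t.corner (k + 2)) = s(p, q) := by
  obtain ⟨t, ⟨a, rfl⟩, ⟨b, rfl⟩⟩ := exists_tri h
  obtain ⟨k, ⟨rfl, rfl⟩ | ⟨rfl, rfl⟩⟩ := fin_three_exists_of_ne fun e => h.ne (congrArg t.corner e)
  · exact ⟨t, k, rfl⟩
  · exact ⟨t, k, Sym2.eq_swap⟩

theorem mem_hex {m n : ℤ} {p : ℤ × ℤ} : p ∈ (Face.hex m n).verts ↔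
    p = (2 * m + 1, 2 * n) ∨ p = (2 * m, 2 * n + 1) ∨ p = (2 * m - 1, 2 * n + 1) ∨
      p = (2 * m - 1, 2 * n) ∨ p = (2 * m, 2 * n - 1) ∨ p = (2 * m + 1, 2 * n - 1) := by
  simp [Face.verts, Fin.exists_fin_succ, unitVec, sub_eq_add_neg, @eq_comm _ p]

theorem isSite_of_mem_face {f : Face} {p : ℤ × ℤ} (h : p ∈ f.verts) : IsSite p := by
  cases f with
  | hex m n =>
    simp only [mem_hex, Prod.ext_iff] at h
    simp only [IsSite, Int.even_iff]
    lia
  | tri t =>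
    obtain ⟨a, rfl⟩ := h
    exact t.isSite_corner a

namespace Tri

variable (t : Tri) (a k : Fin 3)

/-- The index of the hexagon on the other side of the side of `t` opposite to the corner `k`. -/
def hexIdx : ℤ × ℤ :=
  (t.m + (if t.up then 1 else 0) - (![0, t.sgn, 0] : Fin 3 → ℤ) k,
    t.n + (if t.up then 1 else 0) - (![0, 0, t.sgn] : Fin 3 → ℤ) k)

/-- The hexagon on the other side of the side of `t` opposite to the corner `k`. -/
def hexAt : Face := .hex (t.hexIdx k).1 (t.hexIdx k).2

theorem hexIdx_opp_add_one : (t.opp a).hexIdx (a + 1) = t.hexIdx (a + 2) := by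
  obtain ⟨u, m, n⟩ := t
  cases u <;> fin_cases a <;> simp [hexIdx, opp, sgn]

theorem hexIdx_opp_add_two : (t.opp a).hexIdx (a + 2) = t.hexIdx (a + 1) := by
  obtain ⟨u, m, n⟩ := t
  cases u <;> fin_cases a <;> simp [hexIdx, opp, sgn]

theorem hexIdx_injective : Function.Injective t.hexIdx := fun a b h => by
  obtain hs | hs := t.sgn_eq_one_or <;> fin_cases a <;> fin_cases b <;>
    simp [hexIdx, hs, sub_eq_add_neg] at h ⊢

variable {t a k}

theorem corner_mem_hex {m n : ℤ} : t.corner a ∈ (Face.hex m n).verts ↔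
    (m, n) = t.hexIdx (a + 1) ∨ (m, n) = t.hexIdx (a + 2) := by
  obtain ⟨u, x, y⟩ := t
  rw [mem_hex]
  cases u <;> fin_cases a <;> simp [corner, hexIdx, sgn, Prod.ext_iff] <;> lia

variable (t k) in
theorem side_mem_hexAt :
    t.corner (k + 1) ∈ (t.hexAt k).verts ∧ t.corner (k + 2) ∈ (t.hexAt k).verts := by
  simp [hexAt, corner_mem_hex, add_assoc]

theorem eq_or_eq_hexAt_of_side_mem {f : Face} (h₁ : t.corner (k + 1) ∈ f.verts)
    (h₂ : t.corner (k + 2) ∈ f.verts) : f = .tri t ∨ f = t.hexAt k := by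
  cases f with
  | tri t' =>
    exact Or.inl (congrArg Face.tri
      (eq_of_mem₂ (t.corner_side_ne k) h₁ (t.corner_mem _) h₂ (t.corner_mem _)))
  | hex m n =>
    refine Or.inr ?_
    simp only [corner_mem_hex, add_assoc, Fin.reduceAdd, add_zero] at h₁ h₂
    have center : (m, n) = t.hexIdx k := by
      obtain h₁ | h₁ := h₁
      · refine h₂.resolve_right fun h₂ => fin_three_add_one_ne_add_two k ?_
        exact t.hexIdx_injective (h₂.symm.trans h₁)
      · exact h₁
    rw [hexAt, ← center]

end Tri

/-- The side of the triangle `x.1` opposite to its corner number `x.2` belongs to `H`. -/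
def Side (H : kagome.Subgraph) (x : Tri × Fin 3) : Prop :=
  H.Adj (x.1.corner (x.2 + 1)) (x.1.corner (x.2 + 2))

theorem Side.of_tri {t : Tri} (h : HasFace H (.tri t)) (k : Fin 3) : Side H (t, k) :=
  h _ (t.corner_mem _) _ (t.corner_mem _) (t.adj_side k)

theorem Side.of_hexAt {t : Tri} {k : Fin 3} (h : HasFace H (t.hexAt k)) : Side H (t, k) :=
  h _ (t.side_mem_hexAt k).1 _ (t.side_mem_hexAt k).2 (t.adj_side k)

theorem hasFace_tri_iff {t : Tri} : HasFace H (.tri t) ↔ ∀ k, Side H (t, k) := by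
  refine ⟨Side.of_tri, ?_⟩
  rintro h _ ⟨a, rfl⟩ _ ⟨b, rfl⟩ hab
  obtain ⟨k, ⟨rfl, rfl⟩ | ⟨rfl, rfl⟩⟩ :=
    fin_three_exists_of_ne fun e => hab.ne (congrArg t.corner e)
  · exact h k
  · exact (h k).symm

theorem IsLattice.hasFace_of_two_sides (hH : IsLattice H) {t : Tri} {k l : Fin 3} (hkl : k ≠ l)
    (hk : Side H (t, k)) (hl : Side H (t, l)) : HasFace H (.tri t) := by
  have of_consecutive (a : Fin 3) (h₁ : Side H (t, a + 1)) (h₂ : Side H (t, a + 2)) :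
      HasFace H (.tri t) := by
    simp only [Side, add_assoc, Fin.reduceAdd, add_zero] at h₁ h₂
    exact hasFace_of_two hH (t.corner_mem _) (t.corner_mem _) (t.corner_mem _)
      (t.corner_side_ne a).symm h₁ h₂
  obtain ⟨a, ⟨rfl, rfl⟩ | ⟨rfl, rfl⟩⟩ := fin_three_exists_of_ne hkl
  · exact of_consecutive a hk hl
  · exact of_consecutive a hl hk

/-! ### The finite cycles of the tiling are boundaries -/

theorem eq_of_forall_add_one_eq {A : Type*} {f : ℤ → A} (h : ∀ n, f n = f (n + 1)) (m n : ℤ) :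
    f m = f n := by
  have periodic : Function.Periodic f 1 := fun n => (h n).symm
  simpa using (periodic.int_mul_eq m).trans (periodic.int_mul_eq n).symm

section Potential

variable {A : Type*} [AddCommGroup A] {α β a : ℤ × ℤ → A} {N : ℤ}

theorem exists_box {s : Set (ℤ × ℤ)} (hs : s.Finite) : ∃ N : ℤ, ∀ c ∈ s, |c.1| ≤ N ∧ |c.2| ≤ N := by
  obtain ⟨N, hN⟩ := (hs.image fun c => max |c.1| |c.2|).bddAbove
  exact ⟨N, fun c hc => max_le_iff.1 (hN (Set.mem_image_of_mem _ hc))⟩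

theorem eq_zero_of_lt_box (hα : ∀ c ∈ α.support, |c.1| ≤ N ∧ |c.2| ≤ N) {m n : ℤ}
    (h : N < |m| ∨ N < |n|) : α (m, n) = 0 := by
  by_contra hne
  have := hα (m, n) hne
  lia

theorem finite_support_of_differences (hα : α.support.Finite) (hβ : β.support.Finite)
    (a_fst : ∀ m n, a (m, n) = a (m + 1, n) + α (m, n))
    (a_snd : ∀ m n, a (m, n) = a (m, n + 1) + β (m, n))
    (a_right : ∀ m n, N < m → a (m, n) = 0) : a.support.Finite := by
  obtain ⟨K, hK⟩ := exists_box (hα.union hβ)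
  have a_row (m n : ℤ) (h : K < |n|) : a (m, n) = 0 := by
    refine (eq_of_forall_add_one_eq (f := fun m => a (m, n)) (fun m => ?_) m (N + 1)).trans
      (a_right _ n (lt_add_one N))
    rw [a_fst, eq_zero_of_lt_box (fun c hc => hK c (Or.inl hc)) (Or.inr h), add_zero]
  have a_column (m n : ℤ) (h : K < |m|) : a (m, n) = 0 := by
    refine (eq_of_forall_add_one_eq (f := fun n => a (m, n)) (fun n => ?_) n (|K| + 1)).trans
      (a_row m _ (((le_abs_self K).trans_lt (lt_add_one _)).trans_le (le_abs_self _)))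
    rw [a_snd, eq_zero_of_lt_box (fun c hc => hK c (Or.inr hc)) (Or.inl h), add_zero]
  refine ((Set.finite_Icc (-K) K).prod (Set.finite_Icc (-K) K)).subset fun c hc => ?_
  exact ⟨abs_le.1 (not_lt.1 fun h => hc (a_column c.1 c.2 h)),
    abs_le.1 (not_lt.1 fun h => hc (a_row c.1 c.2 h))⟩

theorem exists_potential (hα : α.support.Finite) (hβ : β.support.Finite)
    (curl : ∀ m n, α (m, n) + β (m + 1, n) = β (m, n) + α (m, n + 1)) :
    ∃ a : ℤ × ℤ → A, a.support.Finite ∧ (∀ m n, a (m, n) = a (m + 1, n) + α (m, n)) ∧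
      ∀ m n, a (m, n) = a (m, n + 1) + β (m, n) := by
  obtain ⟨N, hN⟩ := exists_box (hα.union hβ)
  have α_right (m n : ℤ) (h : N < m) : α (m, n) = 0 :=
    eq_zero_of_lt_box (fun c hc => hN c (Or.inl hc)) (Or.inl (h.trans_le (le_abs_self m)))
  have β_right (m n : ℤ) (h : N < m) : β (m, n) = 0 :=
    eq_zero_of_lt_box (fun c hc => hN c (Or.inr hc)) (Or.inl (h.trans_le (le_abs_self m)))
  let a (c : ℤ × ℤ) : A := ∑ j ∈ Finset.Ico c.1 (N + 1), α (j, c.2)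
  have a_right (m n : ℤ) (h : N < m) : a (m, n) = 0 :=
    Finset.sum_eq_zero fun j hj => α_right j n (h.trans_le (Finset.mem_Ico.1 hj).1)
  have a_fst (m n : ℤ) : a (m, n) = a (m + 1, n) + α (m, n) := by
    by_cases hm : N < m
    · rw [a_right m n hm, a_right (m + 1) n (by lia), α_right m n hm, add_zero]
    · simp only [a]
      rw [← Finset.insert_Ico_add_one_left_eq_Ico (by lia : m < N + 1),
        Finset.sum_insert (by simp), add_comm]
  have a_snd (m n : ℤ) : a (m, n) = a (m, n + 1) + β (m, n) := by
    have defect_const (m : ℤ) : a (m, n) - (a (m, n + 1) + β (m, n)) =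
        a (m + 1, n) - (a (m + 1, n + 1) + β (m + 1, n)) := by
      rw [a_fst m n, a_fst m (n + 1), eq_sub_of_add_eq' (curl m n)]
      abel
    have defect_zero : a (m, n) - (a (m, n + 1) + β (m, n)) =
        a (|N| + 1, n) - (a (|N| + 1, n + 1) + β (|N| + 1, n)) :=
      eq_of_forall_add_one_eq (f := fun m => a (m, n) - (a (m, n + 1) + β (m, n))) defect_const ..
    have far : N < |N| + 1 := Int.lt_add_one_of_le (le_abs_self N)
    rwa [a_right _ _ far, a_right _ _ far, β_right _ _ far, add_zero, sub_zero, sub_eq_zero]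
      at defect_zero
  exact ⟨a, finite_support_of_differences hα hβ a_fst a_snd a_right, a_fst, a_snd⟩

end Potential

theorem finite_support_comp_side {A : Type*} [Zero A] {z : Tri × Fin 3 → A} (hz : z.support.Finite)
    (k : Fin 3) (u : Bool) : (fun c : ℤ × ℤ => z (⟨u, c.1, c.2⟩, k)).support.Finite :=
  hz.preimage (f := fun c : ℤ × ℤ => ((⟨u, c.1, c.2⟩ : Tri), k)) fun c _ c' _ h => by
    simpa [Prod.ext_iff] using h

theorem exists_hexagon_chain {z : Tri × Fin 3 → ZMod 2} (hz : z.support.Finite)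
    (cycle : ∀ t a, z (t, a + 1) + z (t, a + 2) + (z (t.opp a, a + 1) + z (t.opp a, a + 2)) = 0) :
    ∃ a : ℤ × ℤ → ZMod 2, a.support.Finite ∧
      ∀ t k, z (t, k) + a (t.hexIdx k) = z (t, 0) + a (t.hexIdx 0) := by
  have finite_add (k : Fin 3) : (fun c : ℤ × ℤ => z (⟨false, c.1, c.2⟩, 0) +
      z (⟨false, c.1, c.2⟩, k)).support.Finite :=
    ((finite_support_comp_side hz 0 false).union (finite_support_comp_side hz k false)).subset
      (Function.support_add _ _)
  -- the sides of the downward triangles define a closed discrete `1`-form on the hexagons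
  obtain ⟨a, ha, a_fst, a_snd⟩ := exists_potential (finite_add 1) (finite_add 2) fun m n => by
    have h₀ := cycle ⟨true, m, n⟩ 0
    have h₁ := cycle ⟨true, m, n⟩ 1
    have h₂ := cycle ⟨true, m, n⟩ 2
    simp [Tri.opp, Tri.sgn] at h₀ h₁ h₂
    grind
  refine ⟨a, ha, ?_⟩
  have down (m n : ℤ) (k : Fin 3) : z (⟨false, m, n⟩, k) + a (Tri.hexIdx ⟨false, m, n⟩ k) =
      z (⟨false, m, n⟩, 0) + a (Tri.hexIdx ⟨false, m, n⟩ 0) := by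
    have h₁ := a_fst m n
    have h₂ := a_snd m n
    fin_cases k <;> simp [Tri.hexIdx, Tri.sgn] <;> grind
  have up (t : Tri) (ht : t.up = true) (b : Fin 3) :
      z (t, b + 1) + a (t.hexIdx (b + 1)) = z (t, b + 2) + a (t.hexIdx (b + 2)) := by
    have opp_eq : t.opp b = ⟨false, (t.opp b).m, (t.opp b).n⟩ := by simp [Tri.opp, ht]
    have h := (down (t.opp b).m (t.opp b).n (b + 1)).trans (down _ _ (b + 2)).symm
    rw [← opp_eq, t.hexIdx_opp_add_one, t.hexIdx_opp_add_two] at h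
    grind
  rintro ⟨_ | _, m, n⟩ k
  · exact down m n k
  · have h₁ := up ⟨true, m, n⟩ rfl 1
    have h₂ := up ⟨true, m, n⟩ rfl 2
    simp only [Fin.reduceAdd] at h₁ h₂
    fin_cases k
    · rfl
    · exact h₂.symm
    · exact h₁

theorem exists_filling {z : Tri × Fin 3 → ZMod 2} (hz : z.support.Finite)
    (cycle : ∀ t a, z (t, a + 1) + z (t, a + 2) + (z (t.opp a, a + 1) + z (t.opp a, a + 2)) = 0) :
    ∃ φ : Face → ZMod 2, φ.support.Finite ∧ ∀ t k, z (t, k) = φ (.tri t) + φ (t.hexAt k) := by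
  obtain ⟨a, ha, constant⟩ := exists_hexagon_chain hz cycle
  let φ : Face → ZMod 2
    | .hex m n => a (m, n)
    | .tri t => z (t, 0) + a (t.hexIdx 0)
  refine ⟨φ, ?_, fun t k => ?_⟩
  · have idx_injective : Function.Injective fun t : Tri => (t.up, t.hexIdx 0) := by
      rintro ⟨u, m, n⟩ ⟨u', m', n'⟩ h
      simp only [Prod.mk.injEq] at h
      obtain ⟨rfl, h⟩ := h
      simpa [Tri.hexIdx] using h
    have finite_tri : {t : Tri | z (t, 0) + a (t.hexIdx 0) ≠ 0}.Finite := by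
      refine ((hz.preimage (f := fun t : Tri => (t, (0 : Fin 3)))
        (Prod.mk_left_injective 0).injOn).union
        ((Set.finite_univ.prod ha).preimage idx_injective.injOn)).subset fun t ht => ?_
      by_contra hnot
      simp_all
    refine ((finite_tri.image Face.tri).union (ha.image fun c => Face.hex c.1 c.2)).subset ?_
    rintro (⟨m, n⟩ | t) hf
    · exact Or.inr ⟨(m, n), hf, rfl⟩
    · exact Or.inl ⟨t, hf, rfl⟩
  · change z (t, k) = z (t, 0) + a (t.hexIdx 0) + a (t.hexIdx k)
    grind

theorem eq_zero_of_boundary_eq_zero {φ : Face → ZMod 2} (hφ : φ.support.Finite)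
    (h : ∀ t k, φ (.tri t) + φ (t.hexAt k) = 0) : φ = 0 := by
  have eq_hexAt (t : Tri) (k : Fin 3) : φ (.tri t) = φ (t.hexAt k) := CharTwo.add_eq_zero.1 (h t k)
  have row_const (m m' n : ℤ) : φ (.hex m n) = φ (.hex m' n) := by
    refine eq_of_forall_add_one_eq (f := fun m => φ (.hex m n)) (fun m => ?_) m m'
    simpa [Tri.hexAt, Tri.hexIdx, Tri.sgn] using
      (eq_hexAt ⟨false, m, n⟩ 0).symm.trans (eq_hexAt ⟨false, m, n⟩ 1)
  have hex_zero (m n : ℤ) : φ (.hex m n) = 0 := by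
    by_contra hne
    have hex_injective : Function.Injective fun m' => Face.hex m' n := fun i j hij => by
      simpa using hij
    exact Set.infinite_of_injective_forall_mem hex_injective
      (fun m' => by rwa [Function.mem_support, row_const m' m]) hφ
  funext f
  cases f with
  | hex m n => exact hex_zero m n
  | tri t => exact (eq_hexAt t 0).trans (hex_zero _ _)

/-! ### The cycle space of a Kagome lattice -/

section ExtendByZero

variable {R α : Type*} [Semiring R] {P : α → Prop}

/-- Extension by zero of a chain on a subtype. -/
noncomputable def extZero (P : α → Prop) : ({x // P x} → R) →ₗ[R] (α → R) :=
  Function.ExtendByZero.linearMap R Subtype.val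

theorem extZero_apply (φ : {x // P x} → R) {x : α} (h : P x) : extZero P φ x = φ ⟨x, h⟩ :=
  Subtype.val_injective.extend_apply φ 0 (⟨x, h⟩ : {x // P x})

theorem extZero_of_not (φ : {x // P x} → R) {x : α} (h : ¬P x) : extZero P φ x = 0 :=
  Function.extend_apply' φ (0 : α → R) x fun ⟨a, ha⟩ => h (ha ▸ a.2)

theorem of_extZero_ne_zero {φ : {x // P x} → R} {x : α} (h : extZero P φ x ≠ 0) : P x :=
  by_contra fun h' => h (extZero_of_not φ h')

theorem extZero_restrict {ψ : α → R} (h : ∀ x, ψ x ≠ 0 → P x) :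
    extZero P (fun x => ψ x.1) = ψ := by
  ext x
  by_cases hx : P x
  · exact extZero_apply _ hx
  · rw [extZero_of_not _ hx]
    exact (not_not.1 (mt (h x) hx)).symm

theorem extZero_injective : Function.Injective (extZero P : ({x // P x} → R) →ₗ[R] (α → R)) :=
  fun φ ψ h => funext fun x => by
    rw [← extZero_apply φ x.2, h, extZero_apply]

theorem extZero_single [DecidableEq α] (i : {x // P x}) (r : R) :
    extZero P (Pi.single i r) = Pi.single i.1 r := by
  ext x
  by_cases hx : P x
  · rw [extZero_apply _ hx]
    simp only [Pi.single_apply, Subtype.ext_iff]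
  · rw [extZero_of_not _ hx, Pi.single_eq_of_ne]
    rintro rfl
    exact hx i.2

end ExtendByZero

variable (H) in
/-- The edges of the lattice, as sides of triangles of the tiling. -/
abbrev SideIdx : Type := {x : Tri × Fin 3 // Side H x}

variable (H) in
/-- The hexagonal faces of the lattice. -/
abbrev HexFace : Type := {c : ℤ × ℤ // HasFace H (.hex c.1 c.2)}

variable (H) in
/-- The triangular faces of the lattice. -/
abbrev TriFace : Type := {t : Tri // HasFace H (.tri t)}

theorem side_injective {t t' : Tri} {k k' : Fin 3}
    (h : s(t.corner (k + 1), t.corner (k + 2)) = s(t'.corner (k' + 1), t'.corner (k' + 2))) :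
    (t, k) = (t', k') := by
  obtain rfl : t = t' := by
    obtain ⟨h₁, h₂⟩ | ⟨h₁, h₂⟩ := Sym2.eq_iff.1 h
    · exact Tri.eq_of_mem₂ (t.corner_side_ne k) (t.corner_mem _) (h₁ ▸ t'.corner_mem _)
        (t.corner_mem _) (h₂ ▸ t'.corner_mem _)
    · exact Tri.eq_of_mem₂ (t.corner_side_ne k) (t.corner_mem _) (h₁ ▸ t'.corner_mem _)
        (t.corner_mem _) (h₂ ▸ t'.corner_mem _)
  simp only [Sym2.eq_iff, t.corner_injective.eq_iff] at h
  rw [Prod.mk.injEq]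
  exact ⟨rfl, by decide +revert⟩

variable (H) in
/-- The edges of the lattice labelled by the sides of the triangles of the tiling, and directed
counterclockwise around their triangle. -/
def sideLabelling : EdgeLabelling H.coe (SideIdx H) where
  dart i := ⟨(⟨i.1.1.corner (i.1.2 + 1), i.2.fst_mem⟩, ⟨i.1.1.corner (i.1.2 + 2), i.2.snd_mem⟩),
    i.2⟩
  existsUnique_edge e he := by
    induction e with
    | _ p q =>
      have hpq : H.Adj p q := he
      obtain ⟨t, k, htk⟩ := exists_side hpq.adj_sub
      have hside : Side H (t, k) := by
        rw [Side, ← SimpleGraph.Subgraph.mem_edgeSet, htk]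
        exact hpq
      refine ⟨⟨(t, k), hside⟩, Sym2.map.injective Subtype.val_injective htk, fun i hi => ?_⟩
      exact Subtype.ext (side_injective ((congrArg (Sym2.map Subtype.val) hi).trans htk.symm))

theorem finite_sideIdx (hH : IsLattice H) : Finite (SideIdx H) := by
  have := hH.finite.to_subtype
  exact Finite.of_injective _ (sideLabelling H).edge_injective

theorem finite_triFace (hH : IsLattice H) : Finite (TriFace H) := by
  have := finite_sideIdx hH
  refine Finite.of_injective (β := SideIdx H) (fun t => ⟨(t.1, 0), .of_tri t.2 0⟩) fun t t' h => ?_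
  exact Subtype.ext (congrArg (·.1.1) h)

theorem hexIdx_down_zero (m n : ℤ) : (Tri.mk false m n).hexIdx 0 = (m, n) := by
  simp [Tri.hexIdx]

theorem finite_hexFace (hH : IsLattice H) : Finite (HexFace H) := by
  have := finite_sideIdx hH
  have side_zero (c : HexFace H) : Side H (⟨false, c.1.1, c.1.2⟩, 0) := by
    refine .of_hexAt ?_
    rw [Tri.hexAt, hexIdx_down_zero]
    exact c.2
  refine Finite.of_injective (β := SideIdx H) (fun c => ⟨_, side_zero c⟩) fun c c' h => ?_
  exact Subtype.ext (Prod.ext (congrArg (·.1.1.m) h) (congrArg (·.1.1.n) h))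

variable (H) in
/-- The mod 2 boundary map from hexagonal faces to edges. -/
noncomputable def hexBoundary : (HexFace H → ZMod 2) →ₗ[ZMod 2] (SideIdx H → ZMod 2) :=
  LinearMap.funLeft (ZMod 2) (ZMod 2) (fun i : SideIdx H => i.1.1.hexIdx i.1.2) ∘ₗ
    extZero fun c : ℤ × ℤ => HasFace H (.hex c.1 c.2)

variable (H) in
/-- The mod 2 boundary map from triangular faces to edges. -/
noncomputable def triBoundary : (TriFace H → ZMod 2) →ₗ[ZMod 2] (SideIdx H → ZMod 2) :=
  LinearMap.funLeft (ZMod 2) (ZMod 2) (fun i : SideIdx H => i.1.1) ∘ₗ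
    extZero fun t => HasFace H (.tri t)

theorem extZero_hexBoundary (φ : HexFace H → ZMod 2) (t : Tri) (k : Fin 3) :
    extZero (Side H) (hexBoundary H φ) (t, k) = extZero _ φ (t.hexIdx k) := by
  by_cases hside : Side H (t, k)
  · exact extZero_apply _ hside
  · rw [extZero_of_not _ hside, extZero_of_not]
    exact fun h => hside (.of_hexAt h)

theorem extZero_triBoundary (φ : TriFace H → ZMod 2) (t : Tri) (k : Fin 3) :
    extZero (Side H) (triBoundary H φ) (t, k) = extZero _ φ t := by
  by_cases hside : Side H (t, k)
  · exact extZero_apply _ hside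
  · rw [extZero_of_not _ hside, extZero_of_not]
    exact fun h => hside (.of_tri h k)

theorem eq_of_dualOff_adj {A : Type*} {φ : Face → A}
    (h : ∀ t k, ¬Side H (t, k) → φ (.tri t) = φ (t.hexAt k)) {f g : Face}
    (hfg : (dualOff H).Adj f g) : φ f = φ g := by
  obtain ⟨-, p, q, hpq, hH, hpf, hqf, hpg, hqg⟩ := hfg
  obtain ⟨t, k, htk⟩ := exists_side hpq
  have hside : ¬Side H (t, k) := by
    rw [Side, ← SimpleGraph.Subgraph.mem_edgeSet, htk]
    exact hH
  have value_eq (f : Face) (hp : p ∈ f.verts) (hq : q ∈ f.verts) : φ f = φ (.tri t) := by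
    have sides_mem : t.corner (k + 1) ∈ f.verts ∧ t.corner (k + 2) ∈ f.verts := by
      obtain ⟨h₁, h₂⟩ | ⟨h₁, h₂⟩ := Sym2.eq_iff.1 htk
      · exact ⟨h₁ ▸ hp, h₂ ▸ hq⟩
      · exact ⟨h₁ ▸ hq, h₂ ▸ hp⟩
    obtain rfl | rfl := Tri.eq_or_eq_hexAt_of_side_mem sides_mem.1 sides_mem.2
    · rfl
    · exact (h t k hside).symm
  rw [value_eq f hpf hqf, value_eq g hpg hqg]

theorem NoHoles.hasFace_of_ne_zero {A : Type*} [Zero A] (hholes : NoHoles H) {φ : Face → A}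
    (hφ : φ.support.Finite) (h : ∀ t k, ¬Side H (t, k) → φ (.tri t) = φ (t.hexAt k)) {f : Face}
    (hf : φ f ≠ 0) : HasFace H f := by
  have eq_of_reachable (g : Face) (hfg : (dualOff H).Reachable f g) : φ f = φ g := by
    obtain ⟨w⟩ := hfg
    induction w with
    | nil => rfl
    | cons hadj _ ih => exact (eq_of_dualOff_adj h hadj).trans (ih (eq_of_dualOff_adj h hadj ▸ hf))
  by_contra hface
  exact hholes f hface (hφ.subset fun g hg => by rwa [Function.mem_support, ← eq_of_reachable g hg])

section Boundary

variable [Fintype (SideIdx H)] [DecidableEq H.verts]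

theorem boundary_single_corner [DecidableEq Tri] (i : SideIdx H) {t : Tri} {a : Fin 3}
    (hp : t.corner a ∈ H.verts) :
    (sideLabelling H).boundary (Pi.single i 1) ⟨t.corner a, hp⟩ =
      (Pi.single i.1 1 : Tri × Fin 3 → ZMod 2) (t, a + 1) +
      (Pi.single i.1 1 : Tri × Fin 3 → ZMod 2) (t, a + 2) +
      ((Pi.single i.1 1 : Tri × Fin 3 → ZMod 2) (t.opp a, a + 1) +
        (Pi.single i.1 1 : Tri × Fin 3 → ZMod 2) (t.opp a, a + 2)) := by
  obtain ⟨⟨t', k⟩, hi⟩ := i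
  have fst_eq : t.corner a = t'.corner (k + 1) ↔ a + 2 = k ∧ (t' = t ∨ t' = t.opp a) := by
    rw [eq_comm, Tri.corner_eq_iff, fin_three_add_one_eq_iff]
  have snd_eq : t.corner a = t'.corner (k + 2) ↔ a + 1 = k ∧ (t' = t ∨ t' = t.opp a) := by
    rw [eq_comm, Tri.corner_eq_iff, fin_three_add_two_eq_iff]
  have opp_ne := t.opp_ne a
  rw [EdgeLabelling.boundary_single]
  simp only [sideLabelling, Pi.add_apply, Pi.single_apply, Subtype.mk.injEq, fst_eq, snd_eq,
    Prod.mk.injEq]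
  by_cases ht : t' = t
  · subst ht
    simp [opp_ne, add_comm]
  · by_cases ht' : t' = t.opp a
    · subst ht'
      simp [opp_ne.symm, add_comm]
    · simp [ht, ht', Ne.symm ht, Ne.symm ht']

theorem boundary_corner (z : SideIdx H → ZMod 2) {t : Tri} {a : Fin 3}
    (hp : t.corner a ∈ H.verts) : (sideLabelling H).boundary z ⟨t.corner a, hp⟩ =
      extZero (Side H) z (t, a + 1) + extZero (Side H) z (t, a + 2) +
      (extZero (Side H) z (t.opp a, a + 1) + extZero (Side H) z (t.opp a, a + 2)) := by
  classical
  let value (x : Tri × Fin 3) : (SideIdx H → ZMod 2) →ₗ[ZMod 2] ZMod 2 :=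
    LinearMap.proj x ∘ₗ extZero (Side H)
  suffices LinearMap.proj ⟨t.corner a, hp⟩ ∘ₗ (sideLabelling H).boundary =
      value (t, a + 1) + value (t, a + 2) + (value (t.opp a, a + 1) + value (t.opp a, a + 2)) from
    LinearMap.congr_fun this z
  refine LinearMap.pi_ext' fun i => LinearMap.ext_ring ?_
  simpa [value, extZero_single] using boundary_single_corner i hp

theorem mem_cycleSpace_of_corners (hH : IsLattice H) {z : SideIdx H → ZMod 2}
    (h : ∀ t a, extZero (Side H) z (t, a + 1) + extZero (Side H) z (t, a + 2) +
      (extZero (Side H) z (t.opp a, a + 1) + extZero (Side H) z (t.opp a, a + 2)) = 0) :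
    z ∈ (sideLabelling H).cycleSpace := by
  rw [EdgeLabelling.cycleSpace, LinearMap.mem_ker]
  ext ⟨p, hp⟩
  obtain ⟨f, -, hpf⟩ := hH.vert_face p hp
  obtain ⟨t, a, -, rfl⟩ := exists_corner (isSite_of_mem_face hpf) true
  rw [boundary_corner, h, Pi.zero_apply]

theorem corner_sum_eq_zero {z : SideIdx H → ZMod 2} (hz : z ∈ (sideLabelling H).cycleSpace)
    (t : Tri) (a : Fin 3) :
    extZero (Side H) z (t, a + 1) + extZero (Side H) z (t, a + 2) +
      (extZero (Side H) z (t.opp a, a + 1) + extZero (Side H) z (t.opp a, a + 2)) = 0 := by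
  by_cases hp : t.corner a ∈ H.verts
  · rw [← boundary_corner z hp, LinearMap.mem_ker.1 hz, Pi.zero_apply]
  · have no_side (t' : Tri) (ht' : t'.corner a = t.corner a) :
        ¬Side H (t', a + 1) ∧ ¬Side H (t', a + 2) := by
      simp only [Side, add_assoc, Fin.reduceAdd, add_zero, ht']
      exact ⟨fun h => hp h.snd_mem, fun h => hp h.fst_mem⟩
    rw [extZero_of_not _ (no_side t rfl).1, extZero_of_not _ (no_side t rfl).2,
      extZero_of_not _ (no_side _ (t.corner_opp a)).1,
      extZero_of_not _ (no_side _ (t.corner_opp a)).2, add_zero, add_zero]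

theorem hexBoundary_mem_cycleSpace (hH : IsLattice H) (φ : HexFace H → ZMod 2) :
    hexBoundary H φ ∈ (sideLabelling H).cycleSpace :=
  mem_cycleSpace_of_corners hH fun t a => by
    simp only [extZero_hexBoundary, Tri.hexIdx_opp_add_one, Tri.hexIdx_opp_add_two]
    grind

theorem triBoundary_mem_cycleSpace (hH : IsLattice H) (φ : TriFace H → ZMod 2) :
    triBoundary H φ ∈ (sideLabelling H).cycleSpace :=
  mem_cycleSpace_of_corners hH fun t a => by
    simp only [extZero_triBoundary]
    grind

theorem exists_faces_of_cycle (hholes : NoHoles H) {z : SideIdx H → ZMod 2}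
    (hz : z ∈ (sideLabelling H).cycleSpace) :
    ∃ (α : HexFace H → ZMod 2) (β : TriFace H → ZMod 2), z = hexBoundary H α + triBoundary H β := by
  have finite_support : (extZero (Side H) z).support.Finite :=
    (Set.finite_coe_iff.1 (inferInstanceAs (Finite (SideIdx H)))).subset fun x => of_extZero_ne_zero
  obtain ⟨φ, hφ, z_eq⟩ := exists_filling finite_support (corner_sum_eq_zero hz)
  have hface (f : Face) (hf : φ f ≠ 0) : HasFace H f :=
    hholes.hasFace_of_ne_zero hφ
      (fun t k hside => CharTwo.add_eq_zero.1 <| by rw [← z_eq, extZero_of_not _ hside]) hf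
  refine ⟨fun c => φ (.hex c.1.1 c.1.2), fun t => φ (.tri t.1), ?_⟩
  apply extZero_injective
  ext ⟨t, k⟩
  rw [map_add, Pi.add_apply, extZero_hexBoundary, extZero_triBoundary,
    extZero_restrict (ψ := fun t : Tri => φ (.tri t)) fun t => hface (.tri t),
    extZero_restrict (ψ := fun c : ℤ × ℤ => φ (.hex c.1 c.2)) fun c => hface (.hex c.1 c.2),
    z_eq, add_comm]
  rfl

end Boundary

theorem eq_zero_of_hexBoundary_add_triBoundary (hH : IsLattice H) {α : HexFace H → ZMod 2}
    {β : TriFace H → ZMod 2} (h : hexBoundary H α + triBoundary H β = 0) : α = 0 ∧ β = 0 := by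
  have := finite_hexFace hH
  have := finite_triFace hH
  let φ : Face → ZMod 2
    | .hex m n => extZero (fun c : ℤ × ℤ => HasFace H (.hex c.1 c.2)) α (m, n)
    | .tri t => extZero (fun t => HasFace H (.tri t)) β t
  have finite_support : φ.support.Finite := by
    refine ((Set.finite_range fun c : HexFace H => Face.hex c.1.1 c.1.2).union
      (Set.finite_range fun t : TriFace H => Face.tri t.1)).subset ?_
    rintro (⟨m, n⟩ | t) hf
    · exact Or.inl ⟨⟨(m, n), of_extZero_ne_zero (x := (m, n)) hf⟩, rfl⟩
    · exact Or.inr ⟨⟨t, of_extZero_ne_zero (x := t) hf⟩, rfl⟩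
  have φ_zero : φ = 0 := eq_zero_of_boundary_eq_zero finite_support fun t k => by
    have value := congrFun (congrArg (extZero (Side H)) h) (t, k)
    rw [map_add, map_zero, Pi.add_apply, extZero_hexBoundary, extZero_triBoundary, add_comm]
      at value
    exact value
  constructor
  · refine extZero_injective ((funext fun c => ?_).trans (map_zero _).symm)
    exact congrFun φ_zero (.hex c.1 c.2)
  · refine extZero_injective ((funext fun t => ?_).trans (map_zero _).symm)
    exact congrFun φ_zero (.tri t)

theorem euler (hH : IsLattice H) (hconn : H.Connected) (hholes : NoHoles H) :
    HF H + TF H + Nat.card H.verts = Nat.card (SideIdx H) + 1 := by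
  classical
  have := hH.finite.fintype
  have := finite_sideIdx hH
  have := finite_hexFace hH
  have := finite_triFace hH
  have := Fintype.ofFinite (SideIdx H)
  have := Fintype.ofFinite (HexFace H)
  have := Fintype.ofFinite (TriFace H)
  let faceBoundary : ((HexFace H → ZMod 2) × (TriFace H → ZMod 2)) →ₗ[ZMod 2]
      (SideIdx H → ZMod 2) := (hexBoundary H).coprod (triBoundary H)
  have injective : Function.Injective faceBoundary := by
    rw [← LinearMap.ker_eq_bot, LinearMap.ker_eq_bot']
    rintro ⟨α, β⟩ h
    exact Prod.ext_iff.2 (eq_zero_of_hexBoundary_add_triBoundary hH h)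
  have range_eq : LinearMap.range faceBoundary = (sideLabelling H).cycleSpace := by
    apply le_antisymm
    · rintro _ ⟨⟨α, β⟩, rfl⟩
      exact add_mem (hexBoundary_mem_cycleSpace hH α) (triBoundary_mem_cycleSpace hH β)
    · intro z hz
      obtain ⟨α, β, rfl⟩ := exists_faces_of_cycle hholes hz
      exact ⟨(α, β), rfl⟩
  have rank_faces := LinearMap.finrank_range_of_inj injective
  have rank_cycles := (sideLabelling H).finrank_cycleSpace_add_card hconn.coe
  rw [range_eq, Module.finrank_prod, Module.finrank_fintype_fun_eq_card,
    Module.finrank_fintype_fun_eq_card] at rank_faces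
  rw [rank_faces] at rank_cycles
  simp only [← Nat.card_eq_fintype_card] at rank_cycles
  exact rank_cycles

/-! ### Counting corners -/

variable (H) in
/-- The corners of triangles of the tiling that are vertices of the lattice. -/
abbrev Corner : Type := {x : Tri × Fin 3 // x.1.corner x.2 ∈ H.verts}

theorem Side.corner_mem {t : Tri} {a k : Fin 3} (h : Side H (t, k)) (hak : a ≠ k) :
    t.corner a ∈ H.verts := by
  obtain rfl | rfl := fin_three_eq_or_of_ne hak
  · exact h.fst_mem
  · exact h.snd_mem

theorem corner_bijective (hH : IsLattice H) : Function.Bijective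
    fun x : Corner H => ((⟨x.1.1.corner x.1.2, x.2⟩, x.1.1.up) : H.verts × Bool) := by
  constructor
  · rintro ⟨⟨t, a⟩, _⟩ ⟨⟨t', a'⟩, _⟩ h
    simp only [Prod.mk.injEq, Subtype.mk.injEq] at h
    obtain ⟨hcorner, hup⟩ := h
    obtain ⟨rfl, rfl | rfl⟩ := Tri.corner_eq_iff.1 hcorner
    · rfl
    · exact absurd hup (Bool.not_ne_self t'.up)
  · rintro ⟨⟨p, hp⟩, u⟩
    obtain ⟨f, -, hpf⟩ := hH.vert_face p hp
    obtain ⟨t, a, rfl, rfl⟩ := exists_corner (isSite_of_mem_face hpf) u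
    exact ⟨⟨(t, a), hp⟩, rfl⟩

theorem card_corner (hH : IsLattice H) : Nat.card (Corner H) = 2 * Nat.card H.verts := by
  rw [Nat.card_eq_of_bijective _ (corner_bijective hH), Nat.card_prod,
    Nat.card_eq_fintype_card (α := Bool), Fintype.card_bool, mul_comm]

theorem card_corner_side {b : Fin 3} (hb : b ≠ 0) :
    Nat.card {x : Corner H // Side H (x.1.1, x.1.2 + b)} = Nat.card (SideIdx H) := by
  refine Nat.card_eq_of_bijective (fun x => ⟨(x.1.1.1, x.1.1.2 + b), x.2⟩) ⟨?_, ?_⟩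
  · rintro ⟨⟨⟨t, a⟩, _⟩, _⟩ ⟨⟨⟨t', a'⟩, _⟩, _⟩ h
    simp only [Subtype.mk.injEq, Prod.mk.injEq, add_left_inj] at h
    obtain ⟨rfl, rfl⟩ := h
    rfl
  · rintro ⟨⟨t, k⟩, h⟩
    have hk : k - b + b = k := sub_add_cancel k b
    exact ⟨⟨⟨(t, k - b), h.corner_mem fun e => hb (sub_eq_self.1 e)⟩, hk.symm ▸ h⟩,
      Subtype.ext (Prod.ext rfl hk)⟩

theorem card_corner_face :
    Nat.card {x : Corner H // HasFace H (.tri x.1.1)} = 3 * TF H := by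
  have card_eq : Nat.card {x : Corner H // HasFace H (.tri x.1.1)} =
      Nat.card (Fin 3 × TriFace H) := by
    refine Nat.card_eq_of_bijective (fun x => (x.1.1.2, ⟨x.1.1.1, x.2⟩)) ⟨?_, ?_⟩
    · rintro ⟨⟨⟨t, a⟩, _⟩, _⟩ ⟨⟨⟨t', a'⟩, _⟩, _⟩ h
      simp only [Subtype.mk.injEq, Prod.mk.injEq] at h
      obtain ⟨rfl, rfl⟩ := h
      rfl
    · rintro ⟨a, ⟨t, ht⟩⟩
      have corner_mem := (Side.of_tri ht (a + 1)).corner_mem (a := a) (by simp)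
      exact ⟨⟨⟨(t, a), corner_mem⟩, ht⟩, rfl⟩
  rw [card_eq, Nat.card_prod, Nat.card_eq_fintype_card (α := Fin 3), Fintype.card_fin]
  rfl

theorem face_eq_tri_opp_of_not_side {t : Tri} {a : Fin 3} (h₁ : ¬Side H (t, a + 1))
    (h₂ : ¬Side H (t, a + 2)) {f : Face} (hf : HasFace H f) (hp : t.corner a ∈ f.verts) :
    f = .tri (t.opp a) := by
  cases f with
  | hex m n =>
    obtain h | h := Tri.corner_mem_hex.1 hp
    · exact absurd (.of_hexAt (by rwa [Tri.hexAt, ← h])) h₁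
    · exact absurd (.of_hexAt (by rwa [Tri.hexAt, ← h])) h₂
  | tri t' =>
    obtain ⟨b, hb⟩ := hp
    obtain ⟨-, rfl | rfl⟩ := Tri.corner_eq_iff.1 hb
    · exact absurd (.of_tri hf _) h₁
    · rfl

theorem hasFace_tri_opp_of_not_side (hH : IsLattice H) {t : Tri} {a : Fin 3}
    (h₁ : ¬Side H (t, a + 1)) (h₂ : ¬Side H (t, a + 2)) (hp : t.corner a ∈ H.verts) :
    HasFace H (.tri (t.opp a)) := by
  obtain ⟨f, hf, hpf⟩ := hH.vert_face _ hp
  rwa [← face_eq_tri_opp_of_not_side h₁ h₂ hf hpf]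

theorem not_side_opp_of_unique_face (hH : IsLattice H) {t : Tri} {a k : Fin 3}
    (unique : ∀ f, HasFace H f → t.corner a ∈ f.verts → f = .tri t) (hak : a ≠ k) :
    ¬Side H (t.opp a, k) := by
  intro hside
  have corner_mem_opp : t.corner a ∈ (t.opp a).verts := t.corner_opp a ▸ (t.opp a).corner_mem a
  obtain ⟨f, hf, h₁, h₂⟩ := hH.edge_face _ _ hside
  have hf_tri : f = .tri t := by
    refine unique f hf ?_
    rw [← t.corner_opp a]
    obtain rfl | rfl := fin_three_eq_or_of_ne hak
    · exact h₁
    · exact h₂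
  subst hf_tri
  exact t.opp_ne a (Tri.eq_of_mem₂ ((t.opp a).corner_side_ne k) (Tri.corner_mem _ _) h₁
    (Tri.corner_mem _ _) h₂)

theorem card_corner_not_side (hH : IsLattice H) :
    Nat.card {x : Corner H // ¬Side H (x.1.1, x.1.2 + 1) ∧ ¬Side H (x.1.1, x.1.2 + 2)} = TC H := by
  rw [TC, ← Nat.card_coe_set_eq]
  refine Nat.card_eq_of_bijective (fun x => ⟨x.1.1.1.corner x.1.1.2, x.1.2, x.1.1.1.opp x.1.1.2,
    hasFace_tri_opp_of_not_side hH x.2.1 x.2.2 x.1.2, Tri.corner_opp _ _ ▸ Tri.corner_mem _ _,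
    fun f => face_eq_tri_opp_of_not_side x.2.1 x.2.2⟩) ⟨?_, ?_⟩
  · rintro ⟨⟨⟨t, a⟩, _⟩, h₁, _⟩ ⟨⟨⟨t', a'⟩, hx'⟩, h₁', h₂'⟩ h
    simp only [Subtype.mk.injEq] at h
    obtain ⟨rfl, rfl | rfl⟩ := Tri.corner_eq_iff.1 h
    · rfl
    · exact absurd (.of_tri (hasFace_tri_opp_of_not_side hH h₁' h₂' hx') _) h₁
  · rintro ⟨p, hp, t, -, ⟨a, rfl⟩, unique⟩
    exact ⟨⟨⟨(t.opp a, a), (t.corner_opp a).symm ▸ hp⟩,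
      not_side_opp_of_unique_face hH unique (by simp),
      not_side_opp_of_unique_face hH unique (by simp)⟩, Subtype.ext (t.corner_opp a)⟩

theorem corner_count (hH : IsLattice H) :
    2 * Nat.card (SideIdx H) + TC H = 3 * TF H + 2 * Nat.card H.verts := by
  classical
  have := hH.finite.to_subtype
  have := Finite.of_injective _ (corner_bijective hH).1
  have := Fintype.ofFinite (Corner H)
  have local_count (x : Corner H) : (if Side H (x.1.1, x.1.2 + 1) then 1 else 0) +
      (if Side H (x.1.1, x.1.2 + 2) then 1 else 0) +
      (if ¬Side H (x.1.1, x.1.2 + 1) ∧ ¬Side H (x.1.1, x.1.2 + 2) then 1 else 0) =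
      (if HasFace H (.tri x.1.1) then 1 else 0) + 1 := by
    have face_iff : HasFace H (.tri x.1.1) ↔
        Side H (x.1.1, x.1.2 + 1) ∧ Side H (x.1.1, x.1.2 + 2) :=
      ⟨fun h => ⟨.of_tri h _, .of_tri h _⟩,
        fun h => hH.hasFace_of_two_sides (fin_three_add_one_ne_add_two _) h.1 h.2⟩
    rw [face_iff]
    by_cases h₁ : Side H (x.1.1, x.1.2 + 1) <;> by_cases h₂ : Side H (x.1.1, x.1.2 + 2) <;>
      simp only [h₁, h₂, not_true_eq_false, not_false_eq_true, and_self, and_true, and_false,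
        if_true, if_false]
  have total := Finset.sum_congr (rfl : (Finset.univ : Finset (Corner H)) = Finset.univ)
    fun x _ => local_count x
  simp only [Finset.sum_add_distrib, Finset.sum_boole, ← Fintype.card_subtype,
    ← Nat.card_eq_fintype_card, Finset.sum_const, Finset.card_univ, smul_eq_mul, mul_one,
    Nat.cast_id] at total
  rw [card_corner_side one_ne_zero, card_corner_side (by decide), card_corner_face,
    card_corner_not_side hH, card_corner hH] at total
  lia

/-! ### The Kagome encoding on closed walks -/

theorem edgeRel_edgeOp (hH : IsLattice H) : EdgeRel H.coe (edgeOp H) where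
  sq h := edgeOp_sq h
  symm h := edgeOp_symm h
  comm h h' hpr hps hqr hqs := by
    rw [edge_edge h h' hpr hps hqr hqs, one_smul]
  anti h h' hpr := by
    rw [edge_edge_anti hH h h' hpr, op_neg_smul, one_smul]

theorem encoding_cycleElt (hH : IsLattice H) {x : H.verts} (w : H.coe.Walk x x) :
    (encoding hH (cycleElt H.coe w) : Op (Qubit H)) = walkOp (edgeOp H) w := by
  have encoding_of (g : Gen H.coe) : encoding hH (PresentedGroup.of g) = genOp H g :=
    PresentedGroup.toGroup.of _
  have coe_opI_pow : ((opI ^ w.length : (Op (Qubit H))ˣ) : Op (Qubit H)) =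
      Complex.I ^ w.length • 1 := by
    rw [Units.val_pow_eq_pow_val, opI, smul_pow, one_pow]
  rw [cycleElt, walkOp, map_mul, map_pow, encoding_of, map_list_prod, List.map_map, Units.val_mul,
    genOp, coe_opI_pow, smul_one_mul, ← Units.coeHom_apply, map_list_prod, List.map_map]
  congr 3

theorem stabilizer_encoding (hH : IsLattice H) :
    stabilizer (encoding hH) = walkGroup H.coe (edgeOp H) := by
  rw [stabilizer, cycleGroup, MonoidHom.map_closure, walkGroup]
  congr 1
  ext u
  constructor
  · rintro ⟨_, ⟨x, w, rfl⟩, rfl⟩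
    exact ⟨x, w, encoding_cycleElt hH w⟩
  · rintro ⟨x, w, hu⟩
    exact ⟨_, ⟨x, w, rfl⟩, Units.ext ((encoding_cycleElt hH w).trans hu.symm)⟩

/-! ### The triangular stabilizers are trivial -/

theorem triOf_corner (t : Tri) {a b : Fin 3} (h : a ≠ b) :
    triOf (t.corner a) (t.corner b) = t :=
  have hadj := t.adj_corner h
  Tri.eq_of_mem₂ hadj.ne (triOf_spec hadj).1 (t.corner_mem a) (triOf_spec hadj).2 (t.corner_mem b)

theorem endPauli_side (t : Tri) (k : Fin 3) :
    endPauli (t.corner (k + 1)) (t.corner (k + 2)) = if t.up then .X else .Y := by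
  rw [endPauli, triOf_corner t (fin_three_add_one_ne_add_two k)]

theorem facePauli_side (t : Tri) (k : Fin 3) :
    facePauli (t.corner (k + 1)) (t.corner (k + 2)) = (![.X, .Y, .Z] : Fin 3 → Pauli) k := by
  obtain hs | hs := t.sgn_eq_one_or <;> fin_cases k <;> simp [facePauli, Tri.corner, hs]

theorem edgeSign_side (t : Tri) (k : Fin 3) :
    edgeSign (t.corner (k + 1)) (t.corner (k + 2)) = 1 := by
  rw [edgeSign, triOf_corner t (fin_three_add_one_ne_add_two k)]
  exact if_pos ⟨k + 1, rfl, by rw [add_assoc]; rfl⟩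

/-- The corners of a triangular face of the lattice, as vertices of the lattice. -/
def faceCorner (t : TriFace H) (a : Fin 3) : H.verts :=
  ⟨t.1.corner a, (Side.of_tri t.2 (a + 1)).corner_mem (by simp)⟩

theorem faceOp_side (t : TriFace H) (k : Fin 3) :
    faceOp H (faceCorner t (k + 1)) (faceCorner t (k + 2)) =
      opOn (Sum.inr t) ((![.X, .Y, .Z] : Fin 3 → Pauli) k).mat := by
  have triOf_eq : triOf (faceCorner t (k + 1) : ℤ × ℤ) (faceCorner t (k + 2)) = t :=
    triOf_corner t.1 (fin_three_add_one_ne_add_two k)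
  have opOn_congr (s : TriFace H) (P : Pauli) (h : s.1 = t.1) :
      opOn (Sum.inr s : Qubit H) P.mat = opOn (Sum.inr t) P.mat := by rw [Subtype.ext h]
  rw [faceOp, dif_pos (triOf_eq ▸ t.2), ← facePauli_side t.1 k]
  exact opOn_congr ⟨_, _⟩ _ triOf_eq

theorem edgeOp_side (t : TriFace H) (k : Fin 3) :
    edgeOp H (faceCorner t (k + 1)) (faceCorner t (k + 2)) =
      opOn (Sum.inl (faceCorner t (k + 1))) (if t.1.up then Pauli.X else .Y).mat *
        opOn (Sum.inl (faceCorner t (k + 2))) (if t.1.up then Pauli.X else .Y).mat *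
        opOn (Sum.inr t) ((![.X, .Y, .Z] : Fin 3 → Pauli) k).mat := by
  rw [edgeOp, faceOp_side]
  simp only [faceCorner, edgeSign_side, endPauli_side, one_smul]

theorem pauli_X_mul_Y_mul_Z :
    Pauli.X.mat * Pauli.Y.mat * Pauli.Z.mat = Complex.I • 1 := by
  ext i j
  fin_cases i <;> fin_cases j <;> simp [Pauli.mat]

theorem mul_mul_mul_of_commute {M : Type*} [Monoid M] {u v w a b c : M} (hv : Commute a v)
    (hw : Commute (a * b) w) : u * a * (v * b) * (w * c) = u * v * w * (a * b * c) :=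
  calc u * a * (v * b) * (w * c) = u * (a * v) * b * w * c := by simp only [mul_assoc]
    _ = u * v * (a * b * w) * c := by rw [hv.eq]; simp only [mul_assoc]
    _ = u * v * w * (a * b * c) := by rw [hw.eq]; simp only [mul_assoc]

theorem edgeOp_triangle (t : TriFace H) :
    edgeOp H (faceCorner t 1) (faceCorner t 2) * edgeOp H (faceCorner t 2) (faceCorner t 0) *
      edgeOp H (faceCorner t 0) (faceCorner t 1) = Complex.I • 1 := by
  let P : Pauli := if t.1.up then .X else .Y
  let x (a : Fin 3) : Op (Qubit H) := opOn (Sum.inl (faceCorner t a)) P.mat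
  let R (A : Matrix (Fin 2) (Fin 2) ℂ) : Op (Qubit H) := opOn (Sum.inr t) A
  have x_sq (a : Fin 3) : x a * x a = 1 := opOn_sq _ _
  have comm (A : Matrix (Fin 2) (Fin 2) ℂ) (a : Fin 3) : Commute (R A) (x a) :=
    opOn_comm Sum.inr_ne_inl _ _
  have sides := congrArg₂ (· * ·) (congrArg₂ (· * ·) (edgeOp_side t 0) (edgeOp_side t 1))
    (edgeOp_side t 2)
  calc _ = x 1 * x 2 * R Pauli.X.mat * (x 2 * x 0 * R Pauli.Y.mat) *
        (x 0 * x 1 * R Pauli.Z.mat) := sides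
    _ = x 1 * x 2 * (x 2 * x 0) * (x 0 * x 1) *
        (R Pauli.X.mat * R Pauli.Y.mat * R Pauli.Z.mat) :=
      mul_mul_mul_of_commute ((comm _ 2).mul_right (comm _ 0))
        (((comm _ 0).mul_right (comm _ 1)).mul_left ((comm _ 0).mul_right (comm _ 1)))
    _ = x 1 * (x 2 * x 2) * (x 0 * x 0) * x 1 * R (Pauli.X.mat * Pauli.Y.mat * Pauli.Z.mat) := by
      simp only [R, opOn_mul, mul_assoc]
    _ = Complex.I • 1 := by
      rw [x_sq, x_sq, mul_one, mul_one, x_sq, one_mul, pauli_X_mul_Y_mul_Z]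
      simp only [R, opOn_smul, opOn_one]

theorem faceCorner_adj (t : TriFace H) (k : Fin 3) :
    H.coe.Adj (faceCorner t (k + 1)) (faceCorner t (k + 2)) :=
  Side.of_tri t.2 k

/-- The closed walk around a triangular face. -/
def triWalk (t : TriFace H) : H.coe.Walk (faceCorner t 1) (faceCorner t 1) :=
  .cons (v := faceCorner t 2) (faceCorner_adj t 0) <|
    .cons (v := faceCorner t 0) (faceCorner_adj t 1) <|
      .cons (v := faceCorner t 1) (faceCorner_adj t 2) .nil

theorem walkOp_triWalk (t : TriFace H) : walkOp (edgeOp H) (triWalk t) = 1 := by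
  have triangle := edgeOp_triangle t
  simp only [walkOp, triWalk, SimpleGraph.Walk.length_cons, SimpleGraph.Walk.length_nil,
    SimpleGraph.Walk.darts_cons, SimpleGraph.Walk.darts_nil, List.map_cons, List.map_nil,
    List.prod_cons, List.prod_nil, mul_one, ← mul_assoc, triangle, smul_smul, ← pow_succ]
  rw [Complex.I_pow_four, one_smul]

open Classical in
theorem triBoundary_single (t : TriFace H) :
    triBoundary H (Pi.single t 1) =
      ∑ k : Fin 3, Pi.single (⟨(t.1, k), .of_tri t.2 k⟩ : SideIdx H) 1 := by
  apply extZero_injective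
  rw [map_sum]
  ext ⟨t', k⟩
  rw [extZero_triBoundary, extZero_single, Finset.sum_apply]
  simp only [extZero_single, Pi.single_apply, Prod.mk.injEq, ite_and, Finset.sum_ite_irrel,
    Finset.sum_ite_eq, Finset.mem_univ, if_true, Finset.sum_const_zero]

open Classical in
theorem chain_triWalk (t : TriFace H) :
    (sideLabelling H).chain (triWalk t) = triBoundary H (Pi.single t 1) := by
  have edgeChain_side (k : Fin 3) : (sideLabelling H).edgeChain
      s(faceCorner t (k + 1), faceCorner t (k + 2)) = Pi.single ⟨(t.1, k), .of_tri t.2 k⟩ 1 :=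
    (sideLabelling H).edgeChain_edge (⟨(t.1, k), .of_tri t.2 k⟩ : SideIdx H)
  rw [triWalk, EdgeLabelling.chain_cons, EdgeLabelling.chain_cons, EdgeLabelling.chain_cons,
    EdgeLabelling.chain_nil, add_zero, triBoundary_single, Fin.sum_univ_three, add_assoc]
  exact congrArg₂ (· + ·) (edgeChain_side 0)
    (congrArg₂ (· + ·) (edgeChain_side 1) (edgeChain_side 2))

/-! ### The stabilizer group -/

open Classical in
theorem skew_opOn_inl (x y : H.verts) {P R : Pauli} (hPR : P ≠ R) :
    Skew (paritySign (if x = y then 1 else 0)) (opOn (Sum.inl x : Qubit H) P.mat)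
      (opOn (Sum.inl y) R.mat) := by
  split_ifs with hxy
  · rw [paritySign_one, hxy]
    exact skew_anti _ hPR
  · rw [AddChar.map_zero_eq_one]
    exact skew_inl hxy _ _

theorem skew_opOn_inl_self (x y : H.verts) (P : Pauli) :
    Skew 1 (opOn (Sum.inl x : Qubit H) P.mat) (opOn (Sum.inl y) P.mat) := by
  by_cases hxy : x = y
  · rw [hxy]
    exact skew_self _
  · exact skew_inl hxy _ _

theorem skew_edgeOp_endPauli (p q x : H.verts) :
    Skew 1 (edgeOp H p q) (opOn (Sum.inl x) (endPauli p q).mat) :=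
  skew_edge (skew_opOn_inl_self p x _) (skew_opOn_inl_self q x _) (skew_face_inl x p q _)
    (by norm_num)

open Classical in
theorem skew_edgeOp_of_ne_endPauli (p q x : H.verts) {P : Pauli} (hP : endPauli p q ≠ P) :
    Skew (paritySign ((if p = x then 1 else 0) + if q = x then 1 else 0)) (edgeOp H p q)
      (opOn (Sum.inl x) P.mat) :=
  skew_edge (skew_opOn_inl p x hP) (skew_opOn_inl q x hP) (skew_face_inl x p q _)
    (by rw [mul_one, AddChar.map_add_eq_mul])

/-- The Pauli that commutes with every edge operator at a vertex, except those of the edges on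
triangles of the same orientation as `t`. -/
def Tri.test (t : Tri) : Pauli := if t.up then .Y else .X

/-- The indicator of the two sides of `t` that meet at its corner `a`. -/
noncomputable def cornerChain (H : kagome.Subgraph) (t : Tri) (a : Fin 3) : SideIdx H → ZMod 2 :=
  open Classical in
  fun i => (if i.1 = (t, a + 2) then 1 else 0) + if i.1 = (t, a + 1) then 1 else 0

theorem Tri.corner_eq_iff_of_up_eq {t t' : Tri} (hup : t'.up = t.up) {a b : Fin 3} :
    t'.corner b = t.corner a ↔ b = a ∧ t' = t := by
  rw [corner_eq_iff, or_iff_left]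
  rintro rfl
  exact Bool.not_ne_self t.up hup

theorem skew_edgeOp_test (i : SideIdx H) (t : Tri) (a : Fin 3) (ha : t.corner a ∈ H.verts) :
    Skew (paritySign (cornerChain H t a i))
      (edgeOp H ((sideLabelling H).dart i).fst ((sideLabelling H).dart i).snd)
      (opOn (Sum.inl ⟨t.corner a, ha⟩) t.test.mat) := by
  classical
  obtain ⟨⟨t', k⟩, hi⟩ := i
  let p : H.verts := ⟨t'.corner (k + 1), hi.fst_mem⟩
  let q : H.verts := ⟨t'.corner (k + 2), hi.snd_mem⟩
  let x : H.verts := ⟨t.corner a, ha⟩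
  have endPauli_eq : endPauli p q = if t'.up then .X else .Y := endPauli_side t' k
  change Skew _ (edgeOp H p q) (opOn (Sum.inl x) _)
  by_cases hup : t'.up = t.up
  · have p_eq_iff : p = x ↔ (t', k) = (t, a + 2) := by
      rw [Subtype.ext_iff, Tri.corner_eq_iff_of_up_eq hup, fin_three_add_one_eq_iff, Prod.mk.injEq,
        and_comm, eq_comm (a := a + 2)]
    have q_eq_iff : q = x ↔ (t', k) = (t, a + 1) := by
      rw [Subtype.ext_iff, Tri.corner_eq_iff_of_up_eq hup, fin_three_add_two_eq_iff, Prod.mk.injEq,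
        and_comm, eq_comm (a := a + 1)]
    have endPauli_ne : endPauli p q ≠ t.test := by
      rw [endPauli_eq, hup, Tri.test]
      cases t.up <;> simp
    simpa only [cornerChain, p_eq_iff, q_eq_iff] using skew_edgeOp_of_ne_endPauli p q x endPauli_ne
  · have ne : t' ≠ t := fun h => hup (congrArg Tri.up h)
    have test_eq : t.test = endPauli p q := by
      rw [endPauli_eq, Bool.eq_not_of_ne hup, Tri.test]
      cases t.up <;> simp
    have chain_eq : cornerChain H t a ⟨(t', k), hi⟩ = 0 := by simp [cornerChain, ne]
    rw [chain_eq, AddChar.map_zero_eq_one, test_eq]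
    exact skew_edgeOp_endPauli p q x

theorem dotProduct_cornerChain [Fintype (SideIdx H)] (z : SideIdx H → ZMod 2) (t : Tri)
    (a : Fin 3) : z ⬝ᵥ cornerChain H t a =
      extZero (Side H) z (t, a + 2) + extZero (Side H) z (t, a + 1) := by
  classical
  have sum_side (x : Tri × Fin 3) :
      ∑ i : SideIdx H, z i * (if i.1 = x then 1 else 0) = extZero (Side H) z x := by
    by_cases hx : Side H x
    · rw [extZero_apply z hx, Finset.sum_eq_single ⟨x, hx⟩] <;> simp +contextual [Subtype.ext_iff]
    · rw [extZero_of_not z hx]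
      exact Finset.sum_eq_zero fun i _ => by
        rw [if_neg fun h : i.1 = x => hx (h ▸ i.2), mul_zero]
  simp only [dotProduct, cornerChain, mul_add, Finset.sum_add_distrib, sum_side]

theorem exists_eq_triBoundary {z : SideIdx H → ZMod 2}
    (hz : ∀ (t : Tri) (a : Fin 3), t.corner a ∈ H.verts →
      extZero (Side H) z (t, a + 2) = extZero (Side H) z (t, a + 1)) :
    ∃ β, z = triBoundary H β := by
  have eq_of_corner (t : Tri) (a : Fin 3) :
      extZero (Side H) z (t, a + 2) = extZero (Side H) z (t, a + 1) := by
    by_cases ha : t.corner a ∈ H.verts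
    · exact hz t a ha
    · rw [extZero_of_not _ fun h => ha (Side.corner_mem h (by simp)),
        extZero_of_not _ fun h => ha (Side.corner_mem h (by simp))]
  have constant (t : Tri) (k : Fin 3) : extZero (Side H) z (t, k) = extZero (Side H) z (t, 0) := by
    fin_cases k
    · rfl
    · exact eq_of_corner t 2
    · exact (eq_of_corner t 0).trans (eq_of_corner t 2)
  refine ⟨fun t => extZero (Side H) z (t.1, 0), extZero_injective ?_⟩
  ext ⟨t, k⟩
  rw [extZero_triBoundary, constant, extZero_restrict (ψ := fun t => extZero (Side H) z (t, 0))]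
  exact fun t ht => hasFace_tri_iff.2 fun k => of_extZero_ne_zero ((constant t k).trans_ne ht)

section SideHom

variable [Fintype H.verts] [Fintype (SideIdx H)] (hH : IsLattice H)

/-- The twisted homomorphism of the Kagome encoding, on mod 2 chains of sides. -/
noncomputable def sideHom : Multiplicative (SideIdx H → ZMod 2) →*
    (Op (Qubit H) ⊗[ℂ] MajoranaAlgebra H.verts)ˣ :=
  twistHom (sideLabelling H) (edgeRel_edgeOp hH)

theorem sideHom_triBoundary (β : TriFace H → ZMod 2) :
    sideHom hH (ofAdd (triBoundary H β)) = 1 := by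
  classical
  have := finite_triFace hH
  have := Fintype.ofFinite (TriFace H)
  induction β using pi_zmod_induction with
  | zero => rw [map_zero, ofAdd_zero, map_one]
  | single t =>
    rw [← chain_triWalk, sideHom, Units.ext_iff, twistHom_chain, walkOp_triWalk]
    rfl
  | add β γ hβ hγ => rw [map_add, ofAdd_add, map_mul, hβ, hγ, one_mul]

theorem exists_eq_triBoundary_of_commute {z : SideIdx H → ZMod 2}
    (hz : ∀ X, Commute (sideHom hH (ofAdd z)) (inclMajorana H.verts (Op (Qubit H)) X)) :
    ∃ β, z = triBoundary H β := by
  refine exists_eq_triBoundary fun t a ha => ?_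
  let X : (Op (Qubit H))ˣ := invol _ (opOn_sq (Sum.inl ⟨t.corner a, ha⟩) t.test)
  rw [← CharTwo.add_eq_zero, ← dotProduct_cornerChain]
  exact dotProduct_eq_zero_of_commute (hE := edgeRel_edgeOp hH) (X := X)
    (c := cornerChain H t a) (fun i => skew_edgeOp_test i t a ha) (hz X)

theorem map_stabilizer (hconn : H.Connected) :
    (stabilizer (encoding hH)).map (inclMajorana H.verts (Op (Qubit H))) =
      (sideLabelling H).cycleSpace.toAddSubgroup.toSubgroup.map (sideHom hH) := by
  classical
  rw [stabilizer_encoding, map_walkGroup (sideLabelling H) (edgeRel_edgeOp hH) hconn.coe, sideHom]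

/-- The operators of the boundaries of sets of hexagonal faces. -/
noncomputable def hexHom : Multiplicative (HexFace H → ZMod 2) →*
    (Op (Qubit H) ⊗[ℂ] MajoranaAlgebra H.verts)ˣ :=
  (sideHom hH).comp (AddMonoidHom.toMultiplicative (hexBoundary H).toAddMonoidHom)

theorem hexHom_injective : Function.Injective (hexHom hH) := by
  rw [injective_iff_map_eq_one]
  intro α hα
  have central : sideHom hH (ofAdd (hexBoundary H α.toAdd)) = 1 := hα
  obtain ⟨β, hβ⟩ := exists_eq_triBoundary_of_commute hH fun X => by
    rw [central]
    exact Commute.one_left _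
  refine (eq_zero_of_hexBoundary_add_triBoundary hH (α := α.toAdd) (β := -β) ?_).1
  rw [hβ, map_neg, add_neg_cancel]

theorem range_hexHom (hconn : H.Connected) (hholes : NoHoles H) :
    (hexHom hH).range = (stabilizer (encoding hH)).map (inclMajorana H.verts (Op (Qubit H))) := by
  rw [map_stabilizer hH hconn]
  apply le_antisymm
  · rintro _ ⟨α, rfl⟩
    exact ⟨_, hexBoundary_mem_cycleSpace hH α.toAdd, rfl⟩
  · rintro _ ⟨z, hz, rfl⟩
    obtain ⟨α, β, z_eq⟩ := exists_faces_of_cycle hholes hz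
    refine ⟨ofAdd α, ?_⟩
    calc hexHom hH (ofAdd α) = sideHom hH (ofAdd (hexBoundary H α + triBoundary H β)) := by
          rw [ofAdd_add, map_mul, sideHom_triBoundary, mul_one]
          rfl
      _ = sideHom hH z := congrArg (sideHom hH) z_eq.symm

end SideHom

theorem neg_one_not_mem_stabilizer (hH : IsLattice H) (hconn : H.Connected) :
    -1 ∉ stabilizer (encoding hH) := by
  intro hmem
  have := hH.finite.fintype
  have := finite_sideIdx hH
  have := Fintype.ofFinite (SideIdx H)
  let ι := inclMajorana H.verts (Op (Qubit H))
  obtain ⟨z, -, hz⟩ : ι (-1) ∈ (sideLabelling H).cycleSpace.toAddSubgroup.toSubgroup.map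
      (sideHom hH) := map_stabilizer hH hconn ▸ Subgroup.mem_map_of_mem ι hmem
  obtain ⟨β, hβ⟩ := exists_eq_triBoundary_of_commute hH (z := z.toAdd) fun X => by
    rw [ofAdd_toAdd, hz]
    exact (Commute.neg_one_left X).map ι
  have neg_one_eq : (-1 : (Op (Qubit H))ˣ) = 1 := inclMajorana_injective <| by
    rw [map_one, ← sideHom_triBoundary hH β, ← hβ]
    exact hz.symm
  have scalar_eq : (-1 : ℂ) • (1 : Op (Qubit H)) = (1 : ℂ) • 1 := by
    rw [one_smul, op_neg_smul, one_smul]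
    exact congrArg Units.val neg_one_eq
  have : (-1 : ℂ) = 1 := smul_left_injective ℂ (one_ne_zero (α := Op (Qubit H))) scalar_eq
  norm_num at this

theorem minGen_stabilizer (hH : IsLattice H) (hconn : H.Connected) (hholes : NoHoles H) :
    minGen (stabilizer (encoding hH)) = HF H := by
  have := hH.finite.fintype
  have := finite_sideIdx hH
  have := Fintype.ofFinite (SideIdx H)
  have := finite_hexFace hH
  have := Fintype.ofFinite (HexFace H)
  calc minGen (stabilizer (encoding hH))
      = minGen ((stabilizer (encoding hH)).map (inclMajorana H.verts (Op (Qubit H)))) :=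
        (minGen_map_of_injective inclMajorana_injective _).symm
    _ = minGen ((⊤ : Subgroup (Multiplicative (HexFace H → ZMod 2))).map (hexHom hH)) := by
        rw [← range_hexHom hH hconn hholes, MonoidHom.range_eq_map]
    _ = minGen (⊤ : Subgroup (Multiplicative (HexFace H → ZMod 2))) :=
        minGen_map_of_injective (hexHom_injective hH) _
    _ = Fintype.card (HexFace H) := minGen_top_multiplicative_pi_zmod _ 2
    _ = HF H := Nat.card_eq_fintype_card.symm

theorem disparity_encoding (hH : IsLattice H) (hconn : H.Connected) (hholes : NoHoles H) :
    disparity (encoding hH) = (TF H : ℤ) - HF H := by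
  have := hH.finite.to_subtype
  have := finite_triFace hH
  have card_qubit : Nat.card (Qubit H) = Nat.card H.verts + TF H := Nat.card_sum
  rw [disparity, minGen_stabilizer hH hconn hholes, card_qubit]
  push_cast
  ring

end Kagome

theorem mainTheorem7 (H : Kagome.kagome.Subgraph) (hH : Kagome.IsLattice H)
    (hconn : H.Connected) (hholes : Kagome.NoHoles H) :
    (-1 ∉ Fermi.stabilizer (Kagome.encoding hH)) ∧
    (Fermi.disparity (Kagome.encoding hH) : ℚ) =
      (Kagome.HF H : ℚ) + (Kagome.TC H : ℚ) - 2 ∧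
    (Fermi.disparity (Kagome.encoding hH) : ℚ) =
      1 / 2 * ((Kagome.TF H : ℚ) + (Kagome.TC H : ℚ) - 2) := by
  have euler := Kagome.euler hH hconn hholes
  have corners := Kagome.corner_count hH
  have faces : (Kagome.TF H + 2 : ℚ) = 2 * Kagome.HF H + Kagome.TC H := by
    exact_mod_cast (by lia : Kagome.TF H + 2 = 2 * Kagome.HF H + Kagome.TC H)
  have disparity : (Fermi.disparity (Kagome.encoding hH) : ℚ) = Kagome.TF H - Kagome.HF H := by
    exact_mod_cast Kagome.disparity_encoding hH hconn hholes
  refine ⟨Kagome.neg_one_not_mem_stabilizer hH hconn, ?_, ?_⟩ <;> linarith
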